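/- **Theorem 4.3 (Upper bound on $Q_\varepsilon$).** Let $d\in\{2,3\}$ and let $\Omega\subset\mathbb R^d$ be a bounded polygonal ($d=2$) or Lipschitz polyhedral ($d=3$) domain with boundary $\Gamma$. For $k>0$, $\varepsilon\in\mathbb R\setminus\{0\}$ and $\eta\in\mathbb C$ put $$a_\varepsilon(u,v)=\int_\Omega\nabla u\cdot\overline{\nabla v}-(k^2+\mathrm i\varepsilon)\int_\Omega u\overline v-\mathrm i\eta\int_\Gamma u\overline v,\qquad \|v\|_{1,k}^2=\|\nabla v\|_{L^2(\Omega)}^2+k^2\|v\|_{L^2(\Omega)}^2,$$ and let $z(k,\varepsilon)$ be the square root of $k^2+\mathrm i\varepsilon$ with positive imaginary part. Let $\mathcal T^h$ and $\mathcal T^H$ be conforming simplicial meshes of $\overline\Omega$ such that each element of $\mathcal T^H$ is a union of elements of $\mathcal T^h$. Let $\mathcal V^h$ be the space of complex-valued continuous functions on $\overline\Omega$ that are affine on each element of $\mathcal T^h$, and let $\mathcal V_0$ be the span of the continuous piecewise affine hat functions of $\mathcal T^H$. Let $\widetilde\Omega_1,\dots,\widetilde\Omega_N\subset\mathbb R^d$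 be open sets covering $\overline\Omega$ such that, with $\Omega_\ell=\widetilde\Omega_\ell\cap\overline\Omega$, each $\overline{\Omega_\ell}$ is non-empty and a union of elements of $\mathcal T^h$, and let $\mathcal V_\ell=\{v\in\mathcal V^h:\operatorname{supp}v\subset\overline{\Omega_\ell}\}$ for $1\le\ell\le N$. Let $C_\varepsilon,C_\eta\in\mathbb R$, $k_0>0$ and $M\in\mathbb N$. There is a constant $C>0$ depending only on $d$, $\Omega$, $C_\varepsilon$, $C_\eta$, $k_0$ and $M$ such that the following holds for all $k\ge k_0$, all $\varepsilon$ with $0<|\varepsilon|\le C_\varepsilon k^2$, all $\eta$ with $|\eta|\le C_\eta k$ and $\operatorname{Re}(\overline{z(k,\varepsilon)}\,\eta)\ge 0$, and all $\mathcal T^h$, $\mathcal T^H$, $N$, $\widetilde\Omega_1,\dots,\widetilde\Omega_N$ as above with $\#\{\ell':\Omega_\ell\cap\Omega_{\ell'}\ne\emptyset\}\le M$ for every $\ell$: for every $v_h\in\mathcal V^h$ and $\ell=0,\dots,N$ there is a unique $Q_{\varepsilon,\ell}v_h\in\mathcal V_\ell$ with $$a_\varepsilon(Q_{\varepsilon,\ell}v_h,w)=a_\varepsilon(v_h,w)\quad\text{for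 all }w\in\mathcal V_\ell,$$ and $Q_\varepsilon v_h:=\sum_{\ell=0}^N Q_{\varepsilon,\ell}v_h$ satisfies $$\|Q_\varepsilon v_h\|_{1,k}\le C\,\frac{k^2}{|\varepsilon|}\,\|v_h\|_{1,k}.$$ In particular $C$ does not depend on $k$, $\varepsilon$, $\eta$, the meshes, the number or sizes of the subdomains, or the overlap. -/

import Mathlib

open scoped MeasureTheory ComplexConjugate

namespace AdditiveSchwarz

/-- The ambient space `ℝ^d` with the Euclidean norm. -/
abbrev Space (d : ℕ) : Type := EuclideanSpace ℝ (Fin d)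

/-! ### The domain -/

/-- Near each of its boundary points, `Ω` is the strict epigraph of a Lipschitz function: for a
suitable unit vector `e` ("vertical direction"), a point `y` close to the boundary point lies in
`Ω` iff its height `⟪e, y⟫` exceeds `φ` at the orthogonal projection of `y` on the hyperplane
`e^⊥`.  (Only the values of `φ` on that hyperplane matter.) -/
def HasLipschitzBoundary {d : ℕ} (Ω : Set (Space d)) : Prop :=
  ∀ x ∈ frontier Ω, ∃ e : Space d, ‖e‖ = 1 ∧
    ∃ (φ : Space d → ℝ) (L : NNReal) (r : ℝ), LipschitzWith L φ ∧ 0 < r ∧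
      ∀ y ∈ Metric.ball x r, (y ∈ Ω ↔ φ (y - (inner ℝ e y) • e) < inner ℝ e y)

/-- `Ω` is a bounded Lipschitz polyhedral domain (polygonal when `d = 2`): its closure is a finite
union of nondegenerate simplices. -/
structure IsLipschitzPolyhedron {d : ℕ} (Ω : Set (Space d)) : Prop where
  isOpen : IsOpen Ω
  isConnected : IsConnected Ω
  isBounded : Bornology.IsBounded Ω
  lipschitz : HasLipschitzBoundary Ω
  polyhedral : ∃ S : Finset (Finset (Space d)),
    (∀ s ∈ S, s.card = d + 1 ∧ AffineIndependent ℝ ((↑) : s → Space d)) ∧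
    closure Ω = ⋃ s ∈ S, convexHull ℝ (s : Set (Space d))

/-! ### Meshes and `P1` finite elements -/

/-- The elements (triangles if `d = 2`, tetrahedra if `d = 3`) of a simplicial complex, given by
their sets of vertices. The element itself is the closed simplex `convexHull ℝ s`. -/
def elements {d : ℕ} (T : Geometry.SimplicialComplex ℝ (Space d)) : Set (Finset (Space d)) :=
  {s | s ∈ T.faces ∧ s.card = d + 1}

/-- `T` is a conforming simplicial mesh of `closure Ω`. Conformity (two elements meet in a common
face or not at all) is part of `Geometry.SimplicialComplex`. -/
structure IsMesh {d : ℕ} (Ω : Set (Space d)) (T : Geometry.SimplicialComplex ℝ (Space d)) :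
    Prop where
  finite : T.faces.Finite
  pure : ∀ s ∈ T.faces, ∃ t ∈ elements T, s ⊆ t
  space_eq : T.space = closure Ω

/-- The set `D` is a union of elements of the mesh `T`. -/
def IsUnionOfElements {d : ℕ} (T : Geometry.SimplicialComplex ℝ (Space d)) (D : Set (Space d)) :
    Prop :=
  ∃ S ⊆ elements T, D = ⋃ s ∈ S, convexHull ℝ (s : Set (Space d))

/-- The `P1` space of the mesh `T`: complex-valued functions on `closure Ω` that are continuous and
affine on each element. Functions on `closure Ω` are represented by functions on `ℝ^d` with the
value `0` outside `closure Ω`. -/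
def p1Space {d : ℕ} (Ω : Set (Space d)) (T : Geometry.SimplicialComplex ℝ (Space d)) :
    Submodule ℂ (Space d → ℂ) where
  carrier := {v | ContinuousOn v (closure Ω) ∧ (∀ x ∉ closure Ω, v x = 0) ∧
    ∀ s ∈ elements T, ∃ g : Space d →ᵃ[ℝ] ℂ, Set.EqOn v g (convexHull ℝ (s : Set (Space d)))}
  zero_mem' := ⟨continuousOn_const, fun _ _ => rfl, fun _ _ => ⟨0, fun _ _ => rfl⟩⟩
  add_mem' := by
    rintro u v ⟨hu, hu0, hua⟩ ⟨hv, hv0, hva⟩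
    refine ⟨hu.add hv, fun x hx => by simp [hu0 x hx, hv0 x hx], fun s hs => ?_⟩
    obtain ⟨f, hf⟩ := hua s hs
    obtain ⟨g, hg⟩ := hva s hs
    exact ⟨f + g, fun x hx => by simp [hf hx, hg hx]⟩
  smul_mem' := by
    rintro c v ⟨hv, hv0, hva⟩
    refine ⟨hv.const_smul c, fun x hx => by simp [hv0 x hx], fun s hs => ?_⟩
    obtain ⟨g, hg⟩ := hva s hs
    exact ⟨c • g, fun x hx => by simp [hg hx]⟩

/-- The nodal (hat) functions `Φ_p` of the mesh `T`: `P1` functions equal to `1` at the node `p` and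
to `0` at all other nodes. -/
def hatFunctions {d : ℕ} (Ω : Set (Space d)) (T : Geometry.SimplicialComplex ℝ (Space d)) :
    Set (Space d → ℂ) :=
  {Φ | Φ ∈ p1Space Ω T ∧ ∃ p ∈ T.vertices, Φ p = 1 ∧ ∀ q ∈ T.vertices, q ≠ p → Φ q = 0}

/-! ### Domain decomposition -/

/-- The subdomain `Ω_ℓ = Ω̃_ℓ ∩ closure Ω`. -/
def subdomain {d N : ℕ} (Ω : Set (Space d)) (Ωt : Fin N → Set (Space d)) (ℓ : Fin N) :
    Set (Space d) :=
  Ωt ℓ ∩ closure Ω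

/-- The open sets `Ω̃_1, …, Ω̃_N` cover `closure Ω`, and each `closure Ω_ℓ` is non-empty and a union
of elements of the fine mesh `Th`. -/
structure IsSubdomainCover {d N : ℕ} (Ω : Set (Space d))
    (Th : Geometry.SimplicialComplex ℝ (Space d)) (Ωt : Fin N → Set (Space d)) : Prop where
  isOpen : ∀ ℓ, IsOpen (Ωt ℓ)
  covers : closure Ω ⊆ ⋃ ℓ, Ωt ℓ
  nonempty : ∀ ℓ, (closure (subdomain Ω Ωt ℓ)).Nonempty
  isUnion : ∀ ℓ, IsUnionOfElements Th (closure (subdomain Ω Ωt ℓ))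

/-- `Λ(ℓ)`: the indices of the subdomains that meet `Ω_ℓ` (including `ℓ` itself). -/
def neighbours {d N : ℕ} (Ω : Set (Space d)) (Ωt : Fin N → Set (Space d)) (ℓ : Fin N) :
    Set (Fin N) :=
  {ℓ' | (subdomain Ω Ωt ℓ ∩ subdomain Ω Ωt ℓ').Nonempty}

/-- The local space on a subdomain `D`: functions `v` of the fine space with
`supp v ⊆ closure D`. -/
def localSpace {d : ℕ} (Ω : Set (Space d)) (Th : Geometry.SimplicialComplex ℝ (Space d))
    (D : Set (Space d)) : Submodule ℂ (Space d → ℂ) where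
  carrier := {v | v ∈ p1Space Ω Th ∧ tsupport v ⊆ closure D}
  zero_mem' := ⟨Submodule.zero_mem _, by simp [tsupport]⟩
  add_mem' := by
    rintro u v ⟨hu, hus⟩ ⟨hv, hvs⟩
    exact ⟨Submodule.add_mem _ hu hv, (tsupport_add u v).trans (Set.union_subset hus hvs)⟩
  smul_mem' := by
    rintro c v ⟨hv, hvs⟩
    exact ⟨Submodule.smul_mem _ c hv,
      (closure_mono (Function.support_const_smul_subset c v)).trans hvs⟩

/-- The coarse space: the span of the hat functions of the coarse mesh `TH`. -/
def coarseSpace {d : ℕ} (Ω : Set (Space d)) (TH : Geometry.SimplicialComplex ℝ (Space d)) :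
    Submodule ℂ (Space d → ℂ) :=
  Submodule.span ℂ (hatFunctions Ω TH)

/-- The spaces `V_0, V_1, …, V_N`: index `0` is the coarse space, index `ℓ` the local space of the
`ℓ`-th subdomain. -/
def schwarzSpace {d N : ℕ} (Ω : Set (Space d)) (Th TH : Geometry.SimplicialComplex ℝ (Space d))
    (Ωt : Fin N → Set (Space d)) : Fin (N + 1) → Submodule ℂ (Space d → ℂ) :=
  Fin.cases (coarseSpace Ω TH) fun ℓ => localSpace Ω Th (subdomain Ω Ωt ℓ)

noncomputable section

/-! ### Forms and norms

On `Ω` the functions of the `P1` spaces are Lipschitz and, off the null set of the element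
boundaries, differentiable; their weak gradient is the classical one. -/

/-- `(∇u, ∇v)_{L²(Ω)}`. -/
def gradInner {d : ℕ} (Ω : Set (Space d)) (u v : Space d → ℂ) : ℂ :=
  ∫ x in Ω, ∑ i : Fin d, fderiv ℝ u x (EuclideanSpace.single i 1) *
    conj (fderiv ℝ v x (EuclideanSpace.single i 1))

/-- `(u, v)_{L²(Ω)}`. -/
def l2Inner {d : ℕ} (Ω : Set (Space d)) (u v : Space d → ℂ) : ℂ :=
  ∫ x in Ω, u x * conj (v x)

/-- `(u, v)_{L²(Γ)}` with `Γ = ∂Ω` and the surface measure: the `(d-1)`-dimensional Hausdorff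
measure in its Euclidean normalisation. -/
def bdryInner {d : ℕ} (Ω : Set (Space d)) (u v : Space d → ℂ) : ℂ :=
  ∫ x in frontier Ω, u x * conj (v x) ∂(μHE[d - 1] : MeasureTheory.Measure (Space d))

/-- The `k`-weighted inner product `(u, v)_{1,k}`. -/
def weightedInner {d : ℕ} (Ω : Set (Space d)) (k : ℝ) (u v : Space d → ℂ) : ℂ :=
  gradInner Ω u v + (k : ℂ) ^ 2 * l2Inner Ω u v

/-- The `k`-weighted norm `‖v‖_{1,k}`. -/
def weightedNorm {d : ℕ} (Ω : Set (Space d)) (k : ℝ) (v : Space d → ℂ) : ℝ :=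
  Real.sqrt (weightedInner Ω k v v).re

/-- The sesquilinear form `a_ε` of the Helmholtz problem with absorption `ε` and impedance
parameter `η`. -/
def form {d : ℕ} (Ω : Set (Space d)) (k ε : ℝ) (η : ℂ) (u v : Space d → ℂ) : ℂ :=
  gradInner Ω u v - ((k : ℂ) ^ 2 + Complex.I * ε) * l2Inner Ω u v
    - Complex.I * η * bdryInner Ω u v

/-- `z(k, ε)`: the square root of `k² + iε` with the branch cut on the positive real axis, i.e.
the square root with positive imaginary part. It is expressed by the principal power, whose cut is
the negative real axis, at `-(k² + iε)`. -/
def wavenumber (k ε : ℝ) : ℂ :=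
  Complex.I * (-((k : ℂ) ^ 2 + Complex.I * ε)) ^ (1 / 2 : ℂ)

/-! ### The additive Schwarz operator -/

/-- `u` solves the projection problem `a_ε(u, w) = a_ε(v, w)` for all `w ∈ W`, with `u ∈ W`. -/
def IsProjection {d : ℕ} (Ω : Set (Space d)) (k ε : ℝ) (η : ℂ)
    (W : Submodule ℂ (Space d → ℂ)) (v u : Space d → ℂ) : Prop :=
  u ∈ W ∧ ∀ w ∈ W, form Ω k ε η u w = form Ω k ε η v w

/-- `Q_{ε,ℓ} v` for `W = V_ℓ`: the solution of the projection problem. -/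
def proj {d : ℕ} (Ω : Set (Space d)) (k ε : ℝ) (η : ℂ)
    (W : Submodule ℂ (Space d → ℂ)) (v : Space d → ℂ) : Space d → ℂ :=
  Classical.epsilon (IsProjection Ω k ε η W v)

/-- The additive Schwarz operator `Q_ε = ∑_{ℓ = 0}^N Q_{ε,ℓ}`. -/
def schwarzOp {d N : ℕ} (Ω : Set (Space d)) (k ε : ℝ) (η : ℂ)
    (Th TH : Geometry.SimplicialComplex ℝ (Space d)) (Ωt : Fin N → Set (Space d))
    (v : Space d → ℂ) : Space d → ℂ :=
  ∑ ℓ : Fin (N + 1), proj Ω k ε η (schwarzSpace Ω Th TH Ωt ℓ) v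

end

end AdditiveSchwarz

/-! The form `a_ε` is coercive up to a phase. With `z = z(k, ε)`, multiplying `a_ε(v, v)` by `i z̄ /
|z|` gives the real part `(Im z (‖∇v‖² + |z|² ‖v‖²) + Re(z̄ η) ‖v‖²_Γ) / |z|`. The boundary term has
a good sign by assumption, `|z| ≥ k`, and `Im z / |z|` is at least a constant times `|ε| / k²`
(`helmholtz_coercive`). The form is also bounded in `‖·‖_{1,k}` uniformly in `k`
(`helmholtzForm_bounded`), because `k ‖v‖²_Γ ≤ K ‖v‖²_{1,k}` with `K` depending only on `Ω` and `k₀`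
(`exists_trace_inequality`).

Coercivity makes every projection problem uniquely solvable (`existsUnique_galerkin`) and bounds the
coarse component. For the local components `q_ℓ`, adding the identities `a(q_ℓ, q_ℓ) = a(v, q_ℓ)`
produces `a(v, ∑ q_ℓ)`, so that coercivity is spent only once and the bound carries the first power
of `k² / |ε|`. Finite overlap enters through `‖∑ q_ℓ‖² ≤ M ∑ ‖q_ℓ‖²` (`norm_sum_sq_le`): subdomains
that do not meet give orthogonal components, since their closures overlap in a null set
(`volume_overlap_eq_zero`).

The trace inequality comes from integrating along segments that enter `Ω` from its boundary in a
locally fixed direction. On almost every such segment a `P1` function is differentiable off a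
countable set (`IsMesh.trace_segment`), and the sweep of these segments is compared with volume by
Fubini in graph coordinates (`lintegral_tube_le`). -/

namespace AdditiveSchwarz

/-! ### Galerkin projections for bounded coercive forms -/

section Abstract

variable {V H : Type*} [AddCommGroup V] [Module ℂ V] [NormedAddCommGroup H]
  [InnerProductSpace ℂ H]

/-- The sesquilinear form `(u, v) ↦ (T u, T v)` induced by a linear map `T`, linear in `u` and
antilinear in `v`. -/
noncomputable def inducedForm (T : V →ₗ[ℂ] H) : V →ₗ[ℂ] V →ₗ⋆[ℂ] ℂ :=
  LinearMap.mk₂'ₛₗ (RingHom.id ℂ) (starRingEnd ℂ) (fun u v => inner ℂ (T v) (T u))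
    (fun _ _ _ => by simp) (fun _ _ _ => by simp) (fun _ _ _ => by simp)
    (fun _ _ _ => by simp [mul_comm])

@[simp]
lemma inducedForm_apply (T : V →ₗ[ℂ] H) (u v : V) : inducedForm T u v = inner ℂ (T v) (T u) :=
  rfl

variable {a : V →ₗ[ℂ] V →ₗ⋆[ℂ] ℂ} {T : V →ₗ[ℂ] H} {θ : ℂ} {A c : ℝ}

/-- Lax–Milgram on a finite-dimensional space. -/
lemma existsUnique_galerkin [FiniteDimensional ℂ V] (hT : Function.Injective T) (hc : 0 < c)
    (hcoer : ∀ v, c * ‖T v‖ ^ 2 ≤ (θ * a v v).re) (W : Submodule ℂ V) (v : V) :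
    ∃! u, u ∈ W ∧ ∀ w ∈ W, a u w = a v w := by
  have hzero : ∀ u, a u u = 0 → u = 0 := by
    intro u hu
    have h := hcoer u
    rw [hu, mul_zero, Complex.zero_re] at h
    have h1 : ‖T u‖ ^ 2 ≤ 0 := nonpos_of_mul_nonpos_right h hc
    have h2 : T u = 0 := by simpa using le_antisymm h1 (sq_nonneg _)
    exact hT (by simpa using h2)
  -- Testing against a basis of `W` turns the problem into a square linear system; coercivity makes
  -- it injective, hence surjective.
  let b := Module.finBasis ℂ W
  let Φ : V →ₗ[ℂ] (Fin (Module.finrank ℂ W) → ℂ) := LinearMap.pi fun i => a.flip (b i)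
  have hΦ : ∀ u, Φ u = 0 → ∀ w ∈ W, a u w = 0 := by
    intro u hu w hw
    have h : (a u).comp W.subtype = 0 := b.ext fun i => by simpa [Φ] using congrFun hu i
    simpa using LinearMap.congr_fun h ⟨w, hw⟩
  have hinj : Function.Injective (Φ.comp W.subtype) := by
    rw [← LinearMap.ker_eq_bot, LinearMap.ker_eq_bot']
    intro u hu
    exact Subtype.ext (hzero u (hΦ u hu u u.2))
  have hsurj : Function.Surjective (Φ.comp W.subtype) :=
    (LinearMap.injective_iff_surjective_of_finrank_eq_finrank (by simp)).1 hinj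
  obtain ⟨u, hu⟩ := hsurj (Φ v)
  have hu' : ∀ w ∈ W, a u w = a v w := by
    intro w hw
    have := hΦ (u - v) (by rw [map_sub]; exact sub_eq_zero.2 hu) w hw
    simpa [sub_eq_zero] using this
  refine ⟨u, ⟨u.2, hu'⟩, fun u' ⟨hmem, h⟩ => ?_⟩
  refine sub_eq_zero.1 (hzero _ ?_)
  have hw := W.sub_mem hmem u.2
  rw [LinearMap.map_sub₂, h _ hw, hu' _ hw, sub_self]

/-- Coercivity and boundedness are compared at the single test function `u`, and one factor `‖T u‖`
cancels. This serves the coarse component. -/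
lemma norm_galerkin_le (hbdd : ∀ u v, ‖a u v‖ ≤ A * ‖T u‖ * ‖T v‖) (hθ : ‖θ‖ ≤ 1)
    (hA : 0 ≤ A) (hcoer : ∀ v, c * ‖T v‖ ^ 2 ≤ (θ * a v v).re) {u v : V} (h : a u u = a v u) :
    c * ‖T u‖ ≤ A * ‖T v‖ := by
  rcases (norm_nonneg (T u)).eq_or_lt with h0 | h0
  · rw [← h0, mul_zero]; positivity
  refine le_of_mul_le_mul_right ?_ h0
  calc c * ‖T u‖ * ‖T u‖ = c * ‖T u‖ ^ 2 := by ring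
    _ ≤ (θ * a u u).re := hcoer u
    _ ≤ ‖θ * a u u‖ := Complex.re_le_norm _
    _ = ‖θ‖ * ‖a v u‖ := by rw [norm_mul, h]
    _ ≤ 1 * (A * ‖T v‖ * ‖T u‖) := by gcongr; exact hbdd v u
    _ = _ := by ring

/-- A sum of vectors, each orthogonal to all but `M` of the others. -/
lemma norm_sum_sq_le {N M : ℕ} (x : Fin N → H) (nb : Fin N → Set (Fin N))
    (hsymm : ∀ i j, j ∈ nb i → i ∈ nb j) (hM : ∀ i, (nb i).ncard ≤ M)
    (horth : ∀ i j, j ∉ nb i → inner ℂ (x i) (x j) = 0) :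
    ‖∑ i, x i‖ ^ 2 ≤ M * ∑ i, ‖x i‖ ^ 2 := by
  classical
  have hcard : ∀ i, ((Finset.univ.filter (· ∈ nb i)).card : ℝ) ≤ M := by
    intro i
    have := hM i
    rw [Set.ncard_eq_toFinset_card'] at this
    refine le_trans (le_of_eq ?_) (Nat.cast_le.2 this)
    congr 2; ext; simp
  have h1 : ‖∑ i, x i‖ ^ 2 = ∑ i, ∑ j, (inner ℂ (x i) (x j)).re := by
    rw [← inner_self_eq_norm_sq (𝕜 := ℂ), sum_inner]
    simp [inner_sum]
  have h2 : ∀ i j, (inner ℂ (x i) (x j)).re ≤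
      if j ∈ nb i then (‖x i‖ ^ 2 + ‖x j‖ ^ 2) / 2 else 0 := by
    intro i j
    split_ifs with h
    · have := (Complex.re_le_norm _).trans (norm_inner_le_norm (𝕜 := ℂ) (x i) (x j))
      nlinarith [sq_nonneg (‖x i‖ - ‖x j‖)]
    · rw [horth i j h]; simp
  have hcount : ∀ y : Fin N → ℝ, (∀ i, 0 ≤ y i) →
      ∑ i, ∑ j, (if j ∈ nb i then y i else 0) ≤ M * ∑ i, y i := by
    intro y hy
    rw [Finset.mul_sum]
    refine Finset.sum_le_sum fun i _ => ?_
    rw [← Finset.sum_filter, Finset.sum_const, nsmul_eq_mul]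
    exact mul_le_mul_of_nonneg_right (hcard i) (hy i)
  have h3 := hcount (fun i => ‖x i‖ ^ 2) fun i => sq_nonneg _
  -- Symmetry of the neighbour relation lets the columns be counted like the rows.
  have h4 : ∑ i, ∑ j, (if j ∈ nb i then ‖x j‖ ^ 2 else 0) =
      ∑ i, ∑ j, (if j ∈ nb i then ‖x i‖ ^ 2 else 0) := by
    rw [Finset.sum_comm]
    refine Finset.sum_congr rfl fun i _ => Finset.sum_congr rfl fun j _ => ?_
    simp only [show i ∈ nb j ↔ j ∈ nb i from ⟨hsymm j i, hsymm i j⟩]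
  calc ‖∑ i, x i‖ ^ 2 ≤ ∑ i, ∑ j, (if j ∈ nb i then (‖x i‖ ^ 2 + ‖x j‖ ^ 2) / 2 else 0) := by
        rw [h1]
        exact Finset.sum_le_sum fun i _ => Finset.sum_le_sum fun j _ => h2 i j
    _ = (∑ i, ∑ j, (if j ∈ nb i then ‖x i‖ ^ 2 else 0) +
          ∑ i, ∑ j, (if j ∈ nb i then ‖x j‖ ^ 2 else 0)) / 2 := by
        simp only [← Finset.sum_add_distrib, Finset.sum_div]
        refine Finset.sum_congr rfl fun i _ => Finset.sum_congr rfl fun j _ => ?_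
        split_ifs <;> simp
    _ ≤ _ := by rw [h4]; linarith

/-- Bounding each `T (u i)` by the global `‖T v‖` would cost a factor depending on `N`. Instead the
energies are summed first: their total is controlled by `a v (∑ i, u i)`, and a factor `‖T (∑ i, u
i)‖` cancels after the overlap bound. -/
lemma norm_sum_galerkin_le {N M : ℕ} (hbdd : ∀ u v, ‖a u v‖ ≤ A * ‖T u‖ * ‖T v‖)
    (hθ : ‖θ‖ ≤ 1) (hA : 0 ≤ A) (hc : 0 ≤ c) (hcoer : ∀ v, c * ‖T v‖ ^ 2 ≤ (θ * a v v).re)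
    (u : Fin N → V) (v : V) (h : ∀ i, a (u i) (u i) = a v (u i)) (nb : Fin N → Set (Fin N))
    (hsymm : ∀ i j, j ∈ nb i → i ∈ nb j) (hM : ∀ i, (nb i).ncard ≤ M)
    (horth : ∀ i j, j ∉ nb i → inner ℂ (T (u i)) (T (u j)) = 0) :
    c * ‖T (∑ i, u i)‖ ≤ A * M * ‖T v‖ := by
  rcases (norm_nonneg (T (∑ i, u i))).eq_or_lt with h0 | h0
  · rw [← h0, mul_zero]; positivity
  refine le_of_mul_le_mul_right ?_ h0
  have h1 := norm_sum_sq_le (fun i => T (u i)) nb hsymm hM horth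
  rw [← map_sum] at h1
  have h2 : c * ∑ i, ‖T (u i)‖ ^ 2 ≤ A * ‖T v‖ * ‖T (∑ i, u i)‖ := by
    calc c * ∑ i, ‖T (u i)‖ ^ 2 ≤ ∑ i, (θ * a (u i) (u i)).re := by
          rw [Finset.mul_sum]; exact Finset.sum_le_sum fun i _ => hcoer _
      _ = (θ * a v (∑ i, u i)).re := by
          rw [map_sum, Finset.mul_sum, Complex.re_sum]; simp [h]
      _ ≤ ‖θ * a v (∑ i, u i)‖ := Complex.re_le_norm _
      _ ≤ 1 * (A * ‖T v‖ * ‖T (∑ i, u i)‖) := by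
          rw [norm_mul]; gcongr; exact hbdd _ _
      _ = _ := one_mul _
  calc c * ‖T (∑ i, u i)‖ * ‖T (∑ i, u i)‖ = c * ‖T (∑ i, u i)‖ ^ 2 := by ring
    _ ≤ c * (M * ∑ i, ‖T (u i)‖ ^ 2) := by gcongr
    _ = M * (c * ∑ i, ‖T (u i)‖ ^ 2) := by ring
    _ ≤ M * (A * ‖T v‖ * ‖T (∑ i, u i)‖) := by gcongr
    _ = _ := by ring

end Abstract

/-! ### The square root `z(k, ε)` and coercivity of the Helmholtz form -/

section Wavenumber

variable {k ε : ℝ}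

lemma wavenumber_sq : wavenumber k ε ^ 2 = (k : ℂ) ^ 2 + Complex.I * ε := by
  rw [wavenumber, mul_pow, Complex.I_sq, one_div, ← Nat.cast_ofNat (R := ℂ) (n := 2),
    Complex.cpow_nat_inv_pow _ (by norm_num)]
  simp

/-- The imaginary part is the real part of a principal square root, which is positive off the
negative real axis; `ε ≠ 0` keeps the radicand off the real axis. -/
lemma wavenumber_im_pos (hε : ε ≠ 0) : 0 < (wavenumber k ε).im := by
  rw [wavenumber, Complex.I_mul_im]
  set w : ℂ := -((k : ℂ) ^ 2 + Complex.I * ε) with hw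
  have him : w.im = -ε := by simp [hw, pow_two]
  have hw0 : w ≠ 0 := fun h => hε (by simpa [h] using him)
  have harg : w.arg ≠ Real.pi := fun h => hε (by
    have := (Complex.arg_eq_pi_iff.1 h).2
    rw [him] at this; linarith)
  have h1 := Complex.neg_pi_lt_arg w
  have h2 := lt_of_le_of_ne (Complex.arg_le_pi w) harg
  rw [Complex.cpow_def_of_ne_zero hw0, Complex.exp_re]
  refine mul_pos (Real.exp_pos _) (Real.cos_pos_of_mem_Ioo ?_)
  have : (Complex.log w * (1 / 2)).im = w.arg / 2 := by
    rw [show (1 / 2 : ℂ) = ((1 / 2 : ℝ) : ℂ) by norm_num, Complex.im_mul_ofReal, Complex.log_im]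
    ring
  rw [this]
  constructor <;> linarith

lemma norm_shift_le {Cε : ℝ} (hε : |ε| ≤ Cε * k ^ 2) :
    ‖(k : ℂ) ^ 2 + Complex.I * ε‖ ≤ (1 + Cε) * k ^ 2 := by
  refine (norm_add_le _ _).trans ?_
  simp only [norm_pow, norm_mul, Complex.norm_real, Complex.norm_I, Real.norm_eq_abs, sq_abs,
    one_mul]
  linarith

lemma le_norm_wavenumber_sq : k ^ 2 ≤ ‖wavenumber k ε‖ ^ 2 := by
  rw [← norm_pow, wavenumber_sq]
  refine le_trans ?_ (Complex.abs_re_le_norm _)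
  simp [pow_two]

/-- From `ε = 2 Re z Im z` follows `|ε| ≤ 2 |z| Im z`; multiply by `|z|` and use `|z|² ≤ (1 + Cε)
k²`. -/
lemma le_wavenumber_im {Cε : ℝ} (hε0 : ε ≠ 0) (hε : |ε| ≤ Cε * k ^ 2) :
    |ε| / (2 * (1 + Cε) * k ^ 2) * ‖wavenumber k ε‖ ≤ (wavenumber k ε).im := by
  set z := wavenumber k ε with hz
  have him : 0 < z.im := wavenumber_im_pos hε0
  have hzn : 0 < ‖z‖ := norm_pos_iff.2 fun h => by simp [h] at him
  have hsq : z ^ 2 = (k : ℂ) ^ 2 + Complex.I * ε := wavenumber_sq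
  have h1 : ‖z‖ ^ 2 ≤ (1 + Cε) * k ^ 2 := by
    rw [← norm_pow, hsq]; exact norm_shift_le hε
  have h2 : ε = 2 * z.re * z.im := by
    have := congrArg Complex.im hsq
    simp [pow_two] at this
    linarith
  have h3 : |ε| ≤ 2 * ‖z‖ * z.im := by
    rw [h2, abs_mul, abs_mul, abs_two, abs_of_pos him]
    gcongr
    exact Complex.abs_re_le_norm z
  have hpos : 0 < (1 + Cε) * k ^ 2 := lt_of_lt_of_le (by positivity) h1
  rw [div_mul_eq_mul_div, div_le_iff₀ (by linarith)]
  nlinarith [mul_le_mul_of_nonneg_left h3 hzn.le, mul_le_mul_of_nonneg_right h1 him.le]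

lemma helmholtz_coercive {Cε g l b : ℝ} {η : ℂ} (hε0 : ε ≠ 0) (hε : |ε| ≤ Cε * k ^ 2)
    (hη : 0 ≤ (conj (wavenumber k ε) * η).re) (hg : 0 ≤ g) (hl : 0 ≤ l) (hb : 0 ≤ b) :
    |ε| / (2 * (1 + Cε) * k ^ 2) * (g + k ^ 2 * l) ≤
      (Complex.I * conj (wavenumber k ε) / ‖wavenumber k ε‖ *
        (g - ((k : ℂ) ^ 2 + Complex.I * ε) * l - Complex.I * η * b)).re := by
  have h1 := le_wavenumber_im hε0 hε
  have h2 := le_norm_wavenumber_sq (k := k) (ε := ε)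
  have him := wavenumber_im_pos (k := k) hε0
  rw [← wavenumber_sq]
  set z := wavenumber k ε
  have hzn : 0 < ‖z‖ := norm_pos_iff.2 fun h => by simp [h] at him
  -- The phase `i z̄` is chosen so that `-i z̄ z² = -i |z|² z` and `i z̄ (-i η) = z̄ η`: all three
  -- terms then have nonnegative real part.
  have key : (Complex.I * conj z / ‖z‖ * (g - z ^ 2 * l - Complex.I * η * b)).re =
      (z.im * (g + ‖z‖ ^ 2 * l) + (conj z * η).re * b) / ‖z‖ := by
    rw [div_mul_eq_mul_div, Complex.div_ofReal_re]
    congr 1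
    rw [← Complex.normSq_eq_norm_sq, Complex.normSq_apply]
    simp [pow_two]
    ring
  rw [key, le_div_iff₀ hzn]
  calc |ε| / (2 * (1 + Cε) * k ^ 2) * (g + k ^ 2 * l) * ‖z‖
      = |ε| / (2 * (1 + Cε) * k ^ 2) * ‖z‖ * (g + k ^ 2 * l) := by ring
    _ ≤ z.im * (g + ‖z‖ ^ 2 * l) := by gcongr
    _ ≤ _ := le_add_of_nonneg_right (mul_nonneg hη hb)

end Wavenumber

/-! ### Tubes above Lipschitz graphs -/

section Tube

open MeasureTheory Measure

variable {n : ℕ}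

lemma euclideanHausdorffMeasure_image_le {X Y : Type*} [EMetricSpace X] [MeasurableSpace X]
    [BorelSpace X] [EMetricSpace Y] [MeasurableSpace Y] [BorelSpace Y] {K : NNReal} {g : X → Y}
    (hg : LipschitzWith K g) (s : Set X) :
    (μHE[n] : Measure Y) (g '' s) ≤ (K : ENNReal) ^ n * (μHE[n] : Measure X) s := by
  simp only [euclideanHausdorffMeasure_def, Measure.smul_apply, ENNReal.smul_def, smul_eq_mul]
  have := hg.hausdorffMeasure_image_le (d := n) (by positivity) s
  rw [ENNReal.rpow_natCast] at this
  calc _ ≤ _ := mul_le_mul_right this _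
    _ = _ := by ring

/-- Orthogonal coordinates `(p, t) ↦ p + t e` on `e^⊥ × ℝ`. -/
noncomputable def orthogonalCoords (e : Space (n + 1)) (he : ‖e‖ = 1) :
    ((Submodule.span ℝ {e})ᗮ × ℝ) ≃L[ℝ] Space (n + 1) :=
  (LinearEquiv.ofBijective
    ((Submodule.span ℝ {e})ᗮ.subtype.coprod (LinearMap.toSpanSingleton ℝ _ e)) (by
      have hee : inner ℝ e e = 1 := by simp [he]
      constructor
      · rw [← LinearMap.ker_eq_bot, LinearMap.ker_eq_bot']
        rintro ⟨p, t⟩ h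
        have hp : inner ℝ e (p : Space (n + 1)) = 0 :=
          Submodule.mem_orthogonal_singleton_iff_inner_right.1 p.2
        simp only [LinearMap.coprod_apply, Submodule.subtype_apply,
          LinearMap.toSpanSingleton_apply] at h
        have ht : t = 0 := by
          have := congrArg (inner ℝ e) h
          simpa only [inner_add_right, inner_smul_right, hp, hee, zero_add, mul_one,
            inner_zero_right] using this
        subst ht
        simpa using h
      · intro x
        refine ⟨(⟨x - (inner ℝ e x : ℝ) • e, ?_⟩, inner ℝ e x), by simp⟩
        rw [Submodule.mem_orthogonal_singleton_iff_inner_right]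
        simp only [inner_sub_right, inner_smul_right, hee]
        ring)).toContinuousLinearEquiv

lemma orthogonalCoords_apply (e : Space (n + 1)) (he : ‖e‖ = 1)
    (p : (Submodule.span ℝ {e})ᗮ) (t : ℝ) :
    orthogonalCoords e he (p, t) = (p : Space (n + 1)) + t • e := rfl

lemma isAddHaarMeasure_orthogonal {e : Space (n + 1)} (he : ‖e‖ = 1) :
    (μHE[n] : Measure (Submodule.span ℝ {e})ᗮ).IsAddHaarMeasure := by
  have hne : e ≠ 0 := by
    rintro rfl
    simp at he
  have : Fact (Module.finrank ℝ (Space (n + 1)) = n + 1) := ⟨by simp⟩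
  have h := isAddHaarMeasure_euclideanHausdorffMeasure (E := (Submodule.span ℝ {e})ᗮ)
  rwa [Submodule.finrank_orthogonal_span_singleton (n := n) hne] at h

/-- Integrals over the tube above a piece `S` of a Lipschitz graph are controlled by volume
integrals. -/
lemma lintegral_tube_le {e : Space (n + 1)} (he : ‖e‖ = 1) {φ : Space (n + 1) → ℝ} {L : NNReal}
    (hφ : LipschitzWith L φ) :
    ∃ C : NNReal, ∀ S : Set (Space (n + 1)), MeasurableSet S →
      (∀ y ∈ S, φ (y - (inner ℝ e y : ℝ) • e) = inner ℝ e y) →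
      ∀ f : Space (n + 1) → ENNReal, Measurable f →
        ∫⁻ y in S, (∫⁻ t : ℝ, f (y + t • e)) ∂(μHE[n] : Measure (Space (n + 1))) ≤
          C * ∫⁻ x, f x := by
  let W := (Submodule.span ℝ {e})ᗮ
  let ν : Measure W := μHE[n]
  have : ν.IsAddHaarMeasure := isAddHaarMeasure_orthogonal he
  let g : W → Space (n + 1) := fun p => p + φ p • e
  have hg : LipschitzWith (1 + L) g := by
    refine LipschitzWith.add (LipschitzWith.subtype_val _) ?_
    refine LipschitzWith.of_dist_le_mul fun p q => ?_
    rw [dist_eq_norm, ← sub_smul, norm_smul, he, mul_one, ← dist_eq_norm]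
    exact hφ.dist_le_mul p q
  have hgm : Measurable g := hg.continuous.measurable
  let Ψ := orthogonalCoords e he
  let μ₁ : Measure (Space (n + 1)) := (ν.prod volume).map Ψ
  have : μ₁.IsAddHaarMeasure := Ψ.isAddHaarMeasure_map _
  let c := addHaarScalarFactor μ₁ volume
  have hc : μ₁ = c • (volume : Measure (Space (n + 1))) := isAddLeftInvariant_eq_smul _ _
  -- The factor `(1 + L) ^ n` is the area distortion of the graph map; `c` compares the product
  -- measure in the coordinates `(p, t)` with Lebesgue measure.
  refine ⟨(1 + L) ^ n * c, fun S hS hgraph f hf => ?_⟩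
  have hmeas : (μHE[n] : Measure (Space (n + 1))).restrict S ≤
      (((1 + L) ^ n : NNReal) : ENNReal) • ν.map g := by
    refine Measure.le_iff.2 fun E hE => ?_
    rw [Measure.restrict_apply hE, Measure.smul_apply, Measure.map_apply hgm hE, smul_eq_mul,
      ENNReal.coe_pow]
    refine le_trans (measure_mono ?_) (euclideanHausdorffMeasure_image_le hg _)
    rintro y ⟨hyE, hyS⟩
    have hp := hgraph y hyS
    have hmem : y - (inner ℝ e y : ℝ) • e ∈ W := by
      rw [Submodule.mem_orthogonal_singleton_iff_inner_right]
      simp [inner_sub_right, inner_smul_right, he]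
    have hgy : g ⟨_, hmem⟩ = y := by simp [g, hp]
    exact ⟨⟨_, hmem⟩, by rwa [Set.mem_preimage, hgy], hgy⟩
  have hFm : Measurable fun y : Space (n + 1) => ∫⁻ t : ℝ, f (y + t • e) := by
    refine Measurable.lintegral_prod_right' (f := fun q : Space (n + 1) × ℝ => f (q.1 + q.2 • e)) ?_
    exact hf.comp (by fun_prop)
  -- Translation by `φ p` straightens the graph: the inner integral runs over the whole line, so its
  -- starting point is irrelevant.
  have hshift : ∀ p : W, ∫⁻ t : ℝ, f (g p + t • e) = ∫⁻ t : ℝ, f (Ψ (p, t)) := by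
    intro p
    rw [← lintegral_add_left_eq_self (fun t : ℝ => f (Ψ (p, t))) (φ p)]
    refine lintegral_congr fun t => ?_
    rw [orthogonalCoords_apply, add_smul, ← add_assoc]
  calc ∫⁻ y in S, (∫⁻ t : ℝ, f (y + t • e)) ∂(μHE[n] : Measure (Space (n + 1)))
      ≤ ∫⁻ y, (∫⁻ t : ℝ, f (y + t • e)) ∂((((1 + L) ^ n : NNReal) : ENNReal) • ν.map g) :=
        lintegral_mono' hmeas le_rfl
    _ = ((1 + L) ^ n : NNReal) * ∫⁻ p, (∫⁻ t : ℝ, f (Ψ (p, t))) ∂ν := by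
        rw [lintegral_smul_measure, lintegral_map hFm hgm, smul_eq_mul]
        simp only [hshift]
    _ = ((1 + L) ^ n : NNReal) * ∫⁻ x, f x ∂μ₁ := by
        rw [lintegral_map hf Ψ.continuous.measurable,
          lintegral_prod (fun q => f (Ψ q)) (hf.comp Ψ.continuous.measurable).aemeasurable]
    _ = _ := by
        rw [hc, ENNReal.smul_def, lintegral_smul_measure, smul_eq_mul, ENNReal.coe_mul, mul_assoc]

end Tube

/-! ### Meshes, `P1` spaces and overlaps -/

section Mesh

open MeasureTheory

variable {d : ℕ} {Ω : Set (Space d)} {T Th TH : Geometry.SimplicialComplex ℝ (Space d)}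

lemma IsMesh.elements_finite (hT : IsMesh Ω T) : (elements T).Finite :=
  hT.finite.subset fun _ hs => hs.1

lemma IsMesh.closure_eq (hT : IsMesh Ω T) :
    closure Ω = ⋃ s ∈ elements T, convexHull ℝ (s : Set (Space d)) := by
  rw [← hT.space_eq]
  refine subset_antisymm (fun x hx => ?_) (Set.iUnion₂_subset fun s hs => ?_)
  · obtain ⟨s, hs, hxs⟩ := Geometry.SimplicialComplex.mem_space_iff.1 hx
    obtain ⟨t, ht, hst⟩ := hT.pure s hs
    exact Set.mem_iUnion₂.2 ⟨t, ht, convexHull_mono (by exact_mod_cast hst) hxs⟩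
  · exact Geometry.SimplicialComplex.convexHull_subset_space hs.1

lemma IsMesh.convexHull_subset (hT : IsMesh Ω T) {s : Finset (Space d)} (hs : s ∈ elements T) :
    convexHull ℝ (s : Set (Space d)) ⊆ closure Ω := by
  rw [hT.closure_eq]
  exact Set.subset_biUnion_of_mem
    (u := fun s : Finset (Space d) => convexHull ℝ (s : Set (Space d))) hs

lemma interior_convexHull_nonempty {s : Finset (Space d)} (hs : s ∈ elements T) :
    (interior (convexHull ℝ (s : Set (Space d)))).Nonempty := by
  rw [interior_convexHull_nonempty_iff_affineSpan_eq_top]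
  have h := (T.indep hs.1).affineSpan_eq_top_iff_card_eq_finrank_add_one
  rw [Subtype.range_coe_subtype] at h
  exact h.2 (by simp [hs.2])

lemma isClosed_convexHull_finset (s : Finset (Space d)) :
    IsClosed (convexHull ℝ (s : Set (Space d))) :=
  (s.finite_toSet.isCompact_convexHull ℝ).isClosed

/-- The union of the boundaries of the elements. -/
def skeleton (T : Geometry.SimplicialComplex ℝ (Space d)) : Set (Space d) :=
  ⋃ s ∈ elements T, frontier (convexHull ℝ (s : Set (Space d)))

lemma IsMesh.isClosed_skeleton (hT : IsMesh Ω T) : IsClosed (skeleton T) :=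
  hT.elements_finite.isClosed_biUnion fun _ _ => isClosed_frontier

lemma IsMesh.volume_skeleton (hT : IsMesh Ω T) : volume (skeleton T) = 0 :=
  (measure_biUnion_null_iff hT.elements_finite.countable).2 fun s _ =>
    (convex_convexHull ℝ (s : Set (Space d))).addHaar_frontier volume

lemma mem_interior_of_notMem_skeleton {x : Space d} (hx : x ∉ skeleton T)
    {s : Finset (Space d)} (hs : s ∈ elements T) (hxs : x ∈ convexHull ℝ (s : Set (Space d))) :
    x ∈ interior (convexHull ℝ (s : Set (Space d))) := by
  by_contra h
  refine hx (Set.mem_iUnion₂.2 ⟨s, hs, ?_⟩)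
  rw [(isClosed_convexHull_finset s).frontier_eq]
  exact ⟨hxs, h⟩

lemma IsMesh.exists_mem_interior (hT : IsMesh Ω T) {x : Space d} (hx : x ∈ closure Ω)
    (hxs : x ∉ skeleton T) :
    ∃ s ∈ elements T, x ∈ interior (convexHull ℝ (s : Set (Space d))) := by
  rw [hT.closure_eq] at hx
  obtain ⟨s, hs, hx⟩ := Set.mem_iUnion₂.1 hx
  exact ⟨s, hs, mem_interior_of_notMem_skeleton hxs hs hx⟩

/-- By conformity the common open set lies in the convex hull of the shared vertices, which must
then number `d + 1`. -/
lemma eq_of_interiors_meet {s t : Finset (Space d)} (hs : s ∈ elements T) (ht : t ∈ elements T)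
    {x : Space d} (hxs : x ∈ interior (convexHull ℝ (s : Set (Space d))))
    (hxt : x ∈ interior (convexHull ℝ (t : Set (Space d)))) : s = t := by
  classical
  have hsub : interior (convexHull ℝ (s : Set (Space d))) ∩
      interior (convexHull ℝ (t : Set (Space d))) ⊆
        convexHull ℝ ((s ∩ t : Finset (Space d)) : Set (Space d)) := by
    rw [Finset.coe_inter]
    exact (Set.inter_subset_inter interior_subset interior_subset).trans
      (T.inter_subset_convexHull hs.1 ht.1)
  have hint : (interior (convexHull ℝ ((s ∩ t : Finset (Space d)) : Set (Space d)))).Nonempty :=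
    ⟨x, interior_maximal hsub (isOpen_interior.inter isOpen_interior) ⟨hxs, hxt⟩⟩
  rw [interior_convexHull_nonempty_iff_affineSpan_eq_top] at hint
  have hind : AffineIndependent ℝ ((↑) : (s ∩ t : Finset (Space d)) → Space d) :=
    (T.indep hs.1).mono (t := (s : Set (Space d)))
      (s := ((s ∩ t : Finset (Space d)) : Set (Space d)))
      (by exact_mod_cast Finset.inter_subset_left)
  have h := hind.affineSpan_eq_top_iff_card_eq_finrank_add_one
  rw [Subtype.range_coe_subtype] at h
  have hcard : (s ∩ t).card = d + 1 := by simpa using h.1 hint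
  have h1 : s ∩ t = s := Finset.eq_of_subset_of_card_le Finset.inter_subset_left
    (by rw [hcard, hs.2])
  have h2 : s ∩ t = t := Finset.eq_of_subset_of_card_le Finset.inter_subset_right
    (by rw [hcard, ht.2])
  exact h1.symm.trans h2

/-- A point of the fine element off the fine skeleton lies in some coarse element, hence in one of
the fine elements composing it. Off the skeleton that element can only be `t`. -/
lemma exists_coarse_element (hTh : IsMesh Ω Th) (hTH : IsMesh Ω TH)
    (hsub : ∀ s ∈ elements TH, IsUnionOfElements Th (convexHull ℝ (s : Set (Space d))))
    {t : Finset (Space d)} (ht : t ∈ elements Th) :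
    ∃ s ∈ elements TH, convexHull ℝ (t : Set (Space d)) ⊆ convexHull ℝ (s : Set (Space d)) := by
  have hpos : 0 < volume (interior (convexHull ℝ (t : Set (Space d)))) :=
    isOpen_interior.measure_pos volume (interior_convexHull_nonempty ht)
  obtain ⟨x, hxt, hx⟩ : (interior (convexHull ℝ (t : Set (Space d))) \ skeleton Th).Nonempty := by
    refine nonempty_of_measure_ne_zero (μ := volume) ?_
    rw [measure_sdiff_null hTh.volume_skeleton]
    exact hpos.ne'
  have hxΩ := hTh.convexHull_subset ht (interior_subset hxt)
  rw [hTH.closure_eq] at hxΩ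
  obtain ⟨s, hs, hxs⟩ := Set.mem_iUnion₂.1 hxΩ
  refine ⟨s, hs, ?_⟩
  obtain ⟨S, hS, heq⟩ := hsub s hs
  rw [heq] at hxs ⊢
  obtain ⟨t', ht', hxt'⟩ := Set.mem_iUnion₂.1 hxs
  obtain rfl := eq_of_interiors_meet ht (hS ht') hxt
    (mem_interior_of_notMem_skeleton hx (hS ht') hxt')
  exact Set.subset_biUnion_of_mem
    (u := fun s : Finset (Space d) => convexHull ℝ (s : Set (Space d))) ht'

lemma coarseSpace_le (hTh : IsMesh Ω Th) (hTH : IsMesh Ω TH)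
    (hsub : ∀ s ∈ elements TH, IsUnionOfElements Th (convexHull ℝ (s : Set (Space d)))) :
    coarseSpace Ω TH ≤ p1Space Ω Th := by
  refine Submodule.span_le.2 ?_
  rintro v ⟨⟨hv, hv0, hva⟩, -⟩
  refine ⟨hv, hv0, fun t ht => ?_⟩
  obtain ⟨s, hs, hts⟩ := exists_coarse_element hTh hTH hsub ht
  obtain ⟨g, hg⟩ := hva s hs
  exact ⟨g, hg.mono hts⟩

lemma localSpace_le (D : Set (Space d)) : localSpace Ω Th D ≤ p1Space Ω Th := fun _ h => h.1

lemma schwarzSpace_le {N : ℕ} {Ωt : Fin N → Set (Space d)} (hTh : IsMesh Ω Th)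
    (hTH : IsMesh Ω TH)
    (hsub : ∀ s ∈ elements TH, IsUnionOfElements Th (convexHull ℝ (s : Set (Space d))))
    (ℓ : Fin (N + 1)) : schwarzSpace Ω Th TH Ωt ℓ ≤ p1Space Ω Th :=
  Fin.cases (coarseSpace_le hTh hTH hsub) (fun _ => localSpace_le _) ℓ

/-- A `P1` function is determined by its values at the finitely many element vertices. -/
lemma finiteDimensional_p1Space (hT : IsMesh Ω T) : FiniteDimensional ℂ (p1Space Ω T) := by
  have hfin : (⋃ s ∈ elements T, (s : Set (Space d))).Finite :=
    hT.elements_finite.biUnion fun s _ => s.finite_toSet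
  have := hfin.to_subtype
  let R : p1Space Ω T →ₗ[ℂ] ((⋃ s ∈ elements T, (s : Set (Space d)) : Set (Space d)) → ℂ) :=
    (LinearMap.funLeft ℂ ℂ (Subtype.val)).comp (p1Space Ω T).subtype
  refine FiniteDimensional.of_injective R ?_
  rw [← LinearMap.ker_eq_bot, LinearMap.ker_eq_bot']
  rintro ⟨v, hvc, hv0, hva⟩ hR
  refine Subtype.ext (funext fun x => ?_)
  by_cases hx : x ∈ closure Ω
  swap
  · exact hv0 x hx
  rw [hT.closure_eq] at hx
  obtain ⟨s, hs, hx⟩ := Set.mem_iUnion₂.1 hx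
  obtain ⟨g, hg⟩ := hva s hs
  have hsg : ∀ y ∈ s, g y = 0 := fun y hy => by
    rw [← hg (subset_convexHull ℝ _ hy)]
    exact congrFun hR ⟨y, Set.mem_iUnion₂.2 ⟨s, hs, hy⟩⟩
  have himg : g x ∈ convexHull ℝ (g '' (s : Set (Space d))) := by
    rw [← AffineMap.image_convexHull]
    exact Set.mem_image_of_mem g hx
  have h0 : g x ∈ convexHull ℝ ({0} : Set ℂ) := by
    refine convexHull_mono ?_ himg
    rintro _ ⟨y, hy, rfl⟩
    exact hsg y hy
  rw [convexHull_singleton] at h0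
  exact (hg hx).trans h0

/-- On each element the derivative of a `P1` function is constant. -/
lemma exists_hasFDerivAt_element {v : Space d → ℂ} (hv : v ∈ p1Space Ω T)
    {s : Finset (Space d)} (hs : s ∈ elements T) :
    ∃ A : Space d →L[ℝ] ℂ,
      ∀ x ∈ interior (convexHull ℝ (s : Set (Space d))), HasFDerivAt v A x := by
  obtain ⟨g, hg⟩ := hv.2.2 s hs
  refine ⟨LinearMap.toContinuousLinearMap g.linear, fun x hx => ?_⟩
  have hgd : HasFDerivAt g (LinearMap.toContinuousLinearMap g.linear) x := by
    have h1 : (g : Space d → ℂ) = fun y => LinearMap.toContinuousLinearMap g.linear y + g 0 := by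
      rw [AffineMap.decomp g]
      ext y
      simp
    rw [h1]
    exact (ContinuousLinearMap.hasFDerivAt _).add_const _
  exact hgd.congr_of_eventuallyEq
    (Filter.eventuallyEq_of_mem (mem_interior_iff_mem_nhds.1 hx) hg)

lemma IsMesh.differentiableAt (hT : IsMesh Ω T) {v : Space d → ℂ} (hv : v ∈ p1Space Ω T)
    {x : Space d} (hx : x ∈ closure Ω) (hxs : x ∉ skeleton T) : DifferentiableAt ℝ v x := by
  obtain ⟨s, hs, hx⟩ := hT.exists_mem_interior hx hxs
  obtain ⟨A, hA⟩ := exists_hasFDerivAt_element hv hs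
  exact (hA x hx).differentiableAt

lemma IsMesh.exists_fderiv_bound (hT : IsMesh Ω T) {v : Space d → ℂ} (hv : v ∈ p1Space Ω T) :
    ∃ K : ℝ, ∀ x ∈ closure Ω, x ∉ skeleton T → ‖fderiv ℝ v x‖ ≤ K := by
  choose! A hA using fun s (hs : s ∈ elements T) => exists_hasFDerivAt_element hv hs
  obtain ⟨K, hK⟩ := (hT.elements_finite.image fun s => ‖A s‖).bddAbove
  refine ⟨K, fun x hx hxs => ?_⟩
  obtain ⟨s, hs, hx⟩ := hT.exists_mem_interior hx hxs
  rw [(hA s hs x hx).fderiv]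
  exact hK ⟨s, hs, rfl⟩

lemma exists_bound {v : Space d → ℂ} (hΩ : Bornology.IsBounded Ω) (hv : v ∈ p1Space Ω T) :
    ∃ K : ℝ, ∀ x ∈ closure Ω, ‖v x‖ ≤ K :=
  hΩ.isCompact_closure.exists_bound_of_continuousOn hv.1

lemma IsMesh.ae_notMem_skeleton (hT : IsMesh Ω T) : ∀ᵐ x, x ∉ skeleton T :=
  measure_eq_zero_iff_ae_notMem.1 hT.volume_skeleton

/-! ### Overlaps -/

lemma volume_frontier_of_isUnionOfElements (hT : IsMesh Ω T) {D : Set (Space d)}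
    (hD : IsUnionOfElements T D) : volume (frontier D) = 0 := by
  obtain ⟨S, hS, rfl⟩ := hD
  refine measure_mono_null (t := skeleton T) (fun x hx => ?_) hT.volume_skeleton
  have hfin := hT.elements_finite.subset hS
  have hcl : IsClosed (⋃ s ∈ S, convexHull ℝ (s : Set (Space d))) :=
    hfin.isClosed_biUnion fun s _ => isClosed_convexHull_finset s
  rw [hcl.frontier_eq] at hx
  obtain ⟨s, hs, hxs⟩ := Set.mem_iUnion₂.1 hx.1
  by_contra h
  refine hx.2 (interior_mono ?_ (mem_interior_of_notMem_skeleton h (hS hs) hxs))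
  exact Set.subset_biUnion_of_mem
    (u := fun s : Finset (Space d) => convexHull ℝ (s : Set (Space d))) hs

/-- If the interiors of the two closures met, openness of `Ωt i` would allow approximating first by
a point of subdomain `i`, then by one of subdomain `j` still inside `Ωt i`, so the subdomains would
meet. What remains of the overlap lies in the frontiers, which are null because the closures are
unions of elements. -/
lemma volume_overlap_eq_zero {N : ℕ} {Ωt : Fin N → Set (Space d)} (hT : IsMesh Ω T)
    (hcov : IsSubdomainCover Ω T Ωt) {i j : Fin N} (hij : j ∉ neighbours Ω Ωt i) :
    volume (closure (subdomain Ω Ωt i) ∩ closure (subdomain Ω Ωt j)) = 0 := by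
  set D := closure (subdomain Ω Ωt i) with hD
  set D' := closure (subdomain Ω Ωt j) with hD'
  have hempty : interior D ∩ interior D' = ∅ := by
    by_contra hne
    obtain ⟨x, hx⟩ := Set.nonempty_iff_ne_empty.2 hne
    obtain ⟨y, hy, hyi⟩ := mem_closure_iff.1 (interior_subset hx.1)
      _ (isOpen_interior.inter isOpen_interior) hx
    obtain ⟨z, hz, hzj⟩ := mem_closure_iff.1 (interior_subset hy.2) _
      ((isOpen_interior.inter isOpen_interior).inter (hcov.isOpen i)) ⟨hy, hyi.1⟩
    exact hij ⟨z, ⟨hz.2, hzj.2⟩, hzj⟩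
  refine measure_mono_null (t := frontier D ∪ frontier D') (fun x hx => ?_)
    (measure_union_null (volume_frontier_of_isUnionOfElements hT (hcov.isUnion i))
      (volume_frontier_of_isUnionOfElements hT (hcov.isUnion j)))
  rw [isClosed_closure.frontier_eq, isClosed_closure.frontier_eq]
  by_contra h
  simp only [Set.mem_union, Set.mem_sdiff, not_or, not_and, not_not] at h
  exact (Set.eq_empty_iff_forall_notMem.1 hempty) x ⟨h.1 hx.1, h.2 hx.2⟩

lemma neighbours_symm {N : ℕ} {Ωt : Fin N → Set (Space d)} (i j : Fin N)
    (h : j ∈ neighbours Ω Ωt i) : i ∈ neighbours Ω Ωt j := by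
  simpa only [neighbours, Set.mem_ofPred_eq, Set.inter_comm] using h

lemma eq_zero_of_mem_localSpace {D : Set (Space d)} {v : Space d → ℂ}
    (hv : v ∈ localSpace Ω T D) {x : Space d} (hx : x ∉ closure D) :
    v x = 0 ∧ fderiv ℝ v x = 0 := by
  have h : x ∉ tsupport v := fun h => hx (hv.2 h)
  refine ⟨image_eq_zero_of_notMem_tsupport h, ?_⟩
  exact fderiv_of_notMem_tsupport ℝ h

end Mesh

/-! ### The trace inequality on a single segment -/

section Trace

open MeasureTheory

/-- Three points cannot lie in `B \ A`: each gap between consecutive ones contains a point of `A`,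
being of positive length, and so the middle one would be in `A`. Countability is what the
fundamental theorem of calculus with exceptional points asks for. -/
lemma countable_sdiff_of_ordConnected {A B : Set ℝ} (hA : A.OrdConnected) (hB : B.OrdConnected)
    (h : volume (B \ A) = 0) : (B \ A).Countable := by
  by_contra hcount
  have hinf : (B \ A).Infinite := fun hf => hcount hf.countable
  obtain ⟨t, ht, hcard⟩ := hinf.exists_subset_card_eq 3
  let f := t.orderEmbOfFin hcard
  have hf : ∀ i, f i ∈ B \ A := fun i => ht (t.orderEmbOfFin_mem hcard i)
  have hmeet : ∀ i j, i < j → (Set.Ioo (f i) (f j) ∩ A).Nonempty := by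
    intro i j hij
    by_contra hne
    have hsub : Set.Ioo (f i) (f j) ⊆ B \ A := fun x hx =>
      ⟨hB.out (hf i).1 (hf j).1 ⟨hx.1.le, hx.2.le⟩, fun hxA => hne ⟨x, hx, hxA⟩⟩
    have h0 := measure_mono_null hsub h
    rw [Real.volume_Ioo, ENNReal.ofReal_eq_zero] at h0
    have : f i < f j := f.strictMono hij
    linarith
  obtain ⟨a, ha, haA⟩ := hmeet 0 1 (by decide)
  obtain ⟨b, hb, hbA⟩ := hmeet 1 2 (by decide)
  exact (hf 1).2 (hA.out haA hbA ⟨ha.2.le, hb.1.le⟩)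

variable {d : ℕ} {Ω : Set (Space d)} {T : Geometry.SimplicialComplex ℝ (Space d)}

lemma ordConnected_line {s : Set (Space d)} (hs : Convex ℝ s) (y e : Space d) :
    {t : ℝ | y + t • e ∈ s}.OrdConnected := by
  have : {t : ℝ | y + t • e ∈ s} = AffineMap.lineMap y (y + e) ⁻¹' s := by
    ext t
    simp [AffineMap.lineMap_apply, add_comm]
  rw [this]
  exact (hs.affine_preimage _).ordConnected

/-- A line meets the skeleton in a null set only if it meets it in a countable set. -/
lemma IsMesh.countable_line_skeleton (hT : IsMesh Ω T) {y e : Space d}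
    (h : volume {t : ℝ | y + t • e ∈ skeleton T} = 0) :
    {t : ℝ | y + t • e ∈ skeleton T}.Countable := by
  have heq : {t : ℝ | y + t • e ∈ skeleton T} =
      ⋃ s ∈ elements T, ({t : ℝ | y + t • e ∈ convexHull ℝ (s : Set (Space d))} \
        {t : ℝ | y + t • e ∈ interior (convexHull ℝ (s : Set (Space d)))}) := by
    ext t
    simp only [skeleton, Set.mem_ofPred_eq, Set.mem_iUnion, Set.mem_sdiff,
      (isClosed_convexHull_finset _).frontier_eq]
  rw [heq] at h ⊢
  refine hT.elements_finite.countable.biUnion fun s hs => ?_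
  have hconv := convex_convexHull ℝ (s : Set (Space d))
  refine countable_sdiff_of_ordConnected (ordConnected_line hconv.interior y e)
    (ordConnected_line hconv y e) ?_
  exact (measure_biUnion_null_iff hT.elements_finite.countable).1 h s hs

lemma measurable_of_mem_p1Space {v : Space d → ℂ} (hv : v ∈ p1Space Ω T) : Measurable v := by
  classical
  have h : (closure Ω).piecewise v 0 = v := by
    ext x
    by_cases hx : x ∈ closure Ω
    · simp [hx]
    · simp [hx, hv.2.1 x hx]
  rw [← h]
  exact hv.1.measurable_piecewise continuousOn_const isClosed_closure.measurableSet

/-- The integrand of the trace inequality. -/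
noncomputable def traceDensity (δ k : ℝ) (v : Space d → ℂ) (x : Space d) : ℝ :=
  ‖v x‖ ^ 2 + δ * (k * ‖v x‖ ^ 2 + k⁻¹ * ‖fderiv ℝ v x‖ ^ 2)

lemma measurable_traceDensity {δ k : ℝ} {v : Space d → ℂ} (hv : Measurable v) :
    Measurable (traceDensity δ k v) := by
  have := measurable_fderiv ℝ v
  unfold traceDensity
  fun_prop

/-- The one-dimensional trace inequality along a segment that enters `Ω`. -/
lemma IsMesh.trace_segment (hT : IsMesh Ω T) (hΩ : Bornology.IsBounded Ω) {v : Space d → ℂ}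
    (hv : v ∈ p1Space Ω T) {y e : Space d} (he : ‖e‖ = 1) {δ k : ℝ} (hδ : 0 < δ) (hk : 0 < k)
    (hseg : ∀ t ∈ Set.Icc 0 δ, y + t • e ∈ closure Ω)
    (hnull : volume {t : ℝ | y + t • e ∈ skeleton T} = 0) :
    ENNReal.ofReal (δ * ‖v y‖ ^ 2) ≤
      ∫⁻ t in Set.Ioc 0 δ, ENNReal.ofReal (traceDensity δ k v (y + t • e)) := by
  have hvm := measurable_of_mem_p1Space hv
  obtain ⟨K₀, hK₀⟩ := exists_bound hΩ hv
  obtain ⟨K₁, hK₁⟩ := hT.exists_fderiv_bound hv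
  have hline : Continuous fun t : ℝ => y + t • e := by fun_prop
  have hae : ∀ᵐ t : ℝ, y + t • e ∉ skeleton T := measure_eq_zero_iff_ae_notMem.1 hnull
  let D : ℝ → ℂ := fun t => fderiv ℝ v (y + t • e) e
  have hDm : Measurable D := (measurable_fderiv_apply_const ℝ v e).comp hline.measurable
  let g : ℝ → ℝ := fun t => ‖v (y + t • e)‖ ^ 2
  let g' : ℝ → ℝ := fun t => 2 * inner ℝ (v (y + t • e)) (D t)
  have hgm : Measurable g := (hvm.comp hline.measurable).norm.pow_const 2
  have hg'm : Measurable g' := ((hvm.comp hline.measurable).inner hDm).const_mul 2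
  have hvline : ContinuousOn (fun t : ℝ => v (y + t • e)) (Set.Icc 0 δ) :=
    hv.1.comp hline.continuousOn hseg
  -- The weight `δ - t` vanishes at the far end, so only the boundary value at `y` survives
  -- integration.
  have hder : ∀ t ∈ Set.Ioo 0 δ \ {t : ℝ | y + t • e ∈ skeleton T},
      HasDerivAt (fun t => (δ - t) * g t) (-g t + (δ - t) * g' t) t := by
    rintro t ⟨ht, hts⟩
    have h1 : HasDerivAt (fun t : ℝ => y + t • e) e t := by
      simpa using ((hasDerivAt_id t).smul_const e).const_add y
    have h2 : HasDerivAt (fun t : ℝ => v (y + t • e)) (D t) t :=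
      (hT.differentiableAt hv (hseg t ⟨ht.1.le, ht.2.le⟩) hts).hasFDerivAt.comp_hasDerivAt t h1
    have h3 : HasDerivAt (fun t : ℝ => δ - t) (-1) t := by
      simpa using (hasDerivAt_id t).const_sub δ
    exact (h3.mul h2.norm_sq).congr_deriv (by simp [g, g'])
  have hDle : ∀ t ∈ Set.Icc 0 δ, y + t • e ∉ skeleton T → ‖D t‖ ≤ K₁ := fun t ht hts =>
    (((fderiv ℝ v (y + t • e)).le_opNorm e).trans (by rw [he, mul_one])).trans
      (hK₁ _ (hseg t ht) hts)
  have hbd : ∀ᵐ t ∂volume.restrict (Set.Ioc 0 δ),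
      ‖-g t + (δ - t) * g' t‖ ≤ K₀ ^ 2 + δ * (2 * (K₀ * K₁)) := by
    filter_upwards [ae_restrict_mem measurableSet_Ioc, ae_restrict_of_ae hae] with t ht hts
    have ht' : t ∈ Set.Icc 0 δ := ⟨ht.1.le, ht.2⟩
    have h1 := hK₀ _ (hseg t ht')
    have h2 := hDle t ht' hts
    have h3 : ‖g t‖ ≤ K₀ ^ 2 := by
      simp only [g, norm_pow, norm_norm]
      gcongr
    have h4 : ‖g' t‖ ≤ 2 * (K₀ * K₁) := by
      simp only [g', norm_mul, Real.norm_ofNat]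
      gcongr
      exact (norm_inner_le_norm _ _).trans (mul_le_mul h1 h2 (norm_nonneg _)
        ((norm_nonneg _).trans h1))
    refine (norm_add_le _ _).trans ?_
    rw [norm_neg, norm_mul]
    refine add_le_add h3 (mul_le_mul ?_ h4 (norm_nonneg _) hδ.le)
    rw [Real.norm_eq_abs, abs_of_nonneg (by linarith [ht.2])]
    linarith [ht.1]
  have hint : IntervalIntegrable (fun t => -g t + (δ - t) * g' t) volume 0 δ := by
    rw [intervalIntegrable_iff_integrableOn_Ioc_of_le hδ.le]
    exact Integrable.of_bound (by fun_prop) _ hbd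
  have hftc := integral_eq_of_hasDerivAt_off_countable_of_le (fun t => (δ - t) * g t)
    (fun t => -g t + (δ - t) * g' t) hδ.le (hT.countable_line_skeleton hnull)
    ((by fun_prop : ContinuousOn (fun t : ℝ => δ - t) _).mul (hvline.norm.pow 2)) hder hint
  have hval : δ * ‖v y‖ ^ 2 = ∫ t in Set.Ioc 0 δ, -(-g t + (δ - t) * g' t) := by
    rw [integral_neg, ← intervalIntegral.integral_of_le hδ.le, hftc]
    simp [g]
  rw [hval]
  refine (ENNReal.ofReal_le_ofReal (le_abs_self _)).trans ?_
  rw [← Real.enorm_eq_ofReal_abs]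
  refine (enorm_integral_le_lintegral_enorm _).trans (lintegral_mono_ae ?_)
  filter_upwards [ae_restrict_mem measurableSet_Ioc] with t ht
  rw [enorm_neg, Real.enorm_eq_ofReal_abs]
  refine ENNReal.ofReal_le_ofReal ?_
  have hg0 : 0 ≤ g t := sq_nonneg _
  have hD : ‖D t‖ ≤ ‖fderiv ℝ v (y + t • e)‖ := by
    simpa [he] using (fderiv ℝ v (y + t • e)).le_opNorm e
  have hg' : |g' t| ≤ k * ‖v (y + t • e)‖ ^ 2 + k⁻¹ * ‖fderiv ℝ v (y + t • e)‖ ^ 2 := by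
    set a := ‖v (y + t • e)‖ with ha
    set b := ‖fderiv ℝ v (y + t • e)‖ with hb
    have h1 : |g' t| ≤ 2 * (a * b) := by
      simp only [g', abs_mul, abs_two]
      gcongr
      exact (abs_real_inner_le_norm _ _).trans (by gcongr)
    -- Young's inequality, weighted by `k` to match the weighted norm.
    have h2 : 0 ≤ k⁻¹ * (k * a - b) ^ 2 := by positivity
    have h3 : k⁻¹ * (k * a - b) ^ 2 = k * a ^ 2 + k⁻¹ * b ^ 2 - 2 * (a * b) := by
      field_simp
      ring
    linarith
  calc |-g t + (δ - t) * g' t| ≤ |-g t| + |(δ - t) * g' t| := abs_add_le _ _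
    _ ≤ g t + δ * (k * ‖v (y + t • e)‖ ^ 2 + k⁻¹ * ‖fderiv ℝ v (y + t • e)‖ ^ 2) := by
      rw [abs_neg, abs_of_nonneg hg0, abs_mul]
      gcongr
      rw [abs_of_nonneg (by linarith [ht.2])]
      linarith [ht.1]
    _ = _ := rfl

end Trace

/-! ### The trace inequality on the boundary -/

section Trace

open MeasureTheory

variable {n : ℕ} {Ω : Set (Space (n + 1))}

/-- Near a boundary point, the segments in a fixed direction of a fixed length starting on the
boundary sweep out a tube in `Ω`. -/
lemma exists_tube (hΩ : IsOpen Ω) (hlip : HasLipschitzBoundary Ω) {x : Space (n + 1)}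
    (hx : x ∈ frontier Ω) :
    ∃ (e : Space (n + 1)) (δ : ℝ) (C : NNReal), ‖e‖ = 1 ∧ 0 < δ ∧
      (∀ y ∈ frontier Ω ∩ Metric.ball x δ, ∀ t ∈ Set.Ioc 0 δ, y + t • e ∈ Ω) ∧
      ∀ f : Space (n + 1) → ENNReal, Measurable f →
        ∫⁻ y in frontier Ω ∩ Metric.ball x δ, (∫⁻ t : ℝ, f (y + t • e))
          ∂(μHE[n] : Measure (Space (n + 1))) ≤ C * ∫⁻ x, f x := by
  obtain ⟨e, he, φ, L, r, hφ, hr, hloc⟩ := hlip x hx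
  obtain ⟨C, hC⟩ := lintegral_tube_le he hφ
  have hheight : Continuous fun y : Space (n + 1) => inner ℝ e y - φ (y - inner ℝ e y • e) := by
    have := hφ.continuous
    fun_prop
  -- Boundary points lie on the graph: as limits of points of `Ω` they are not below it, and as
  -- non-members of the open set `Ω` they are not above it.
  have hgraph : ∀ y ∈ frontier Ω ∩ Metric.ball x (r / 2),
      φ (y - (inner ℝ e y : ℝ) • e) = inner ℝ e y := by
    rintro y ⟨hy, hyx⟩
    have hyr : y ∈ Metric.ball x r := Metric.ball_subset_ball (by linarith) hyx
    refine le_antisymm ?_ (not_lt.1 fun h => ?_)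
    · have hmem : y ∈ closure {z : Space (n + 1) | 0 ≤ inner ℝ e z - φ (z - inner ℝ e z • e)} := by
        rw [mem_closure_iff]
        intro o ho hyo
        obtain ⟨z, hz, hzΩ⟩ := mem_closure_iff.1 (frontier_subset_closure hy) _
          (ho.inter Metric.isOpen_ball) ⟨hyo, hyr⟩
        exact ⟨z, hz.1, (sub_pos.2 ((hloc z hz.2).1 hzΩ)).le⟩
      rw [(isClosed_le continuous_const hheight).closure_eq] at hmem
      exact sub_nonneg.1 hmem
    · have := (hloc y hyr).2 h
      rw [hΩ.frontier_eq] at hy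
      exact hy.2 this
  -- Halving `r` keeps segments of length `r / 2` from the smaller ball inside the chart.
  refine ⟨e, r / 2, C, he, by linarith, fun y hy t ht => ?_,
    fun f hf => hC _ (isClosed_frontier.measurableSet.inter measurableSet_ball) hgraph f hf⟩
  have hball : y + t • e ∈ Metric.ball x r := by
    rw [Metric.mem_ball]
    calc dist (y + t • e) x ≤ dist (y + t • e) y + dist y x := dist_triangle _ _ _
      _ < r / 2 + r / 2 := by
        refine add_lt_add_of_le_of_lt ?_ hy.2
        rw [dist_eq_norm, add_sub_cancel_left, norm_smul, he, mul_one, Real.norm_eq_abs,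
          abs_of_pos ht.1]
        exact ht.2
      _ = r := by ring
  have hinner : inner ℝ e (y + t • e) = inner ℝ e y + t := by
    simp [inner_add_right, inner_smul_right, he]
  rw [hloc _ hball, hinner, show y + t • e - (inner ℝ e y + t) • e = y - inner ℝ e y • e by
    rw [add_smul]; abel, hgraph y hy]
  linarith [ht.1]

/-- The multiplicative trace inequality on a piece `S` of the boundary, with `S` of finite surface
measure. -/
def HasTraceInequality (Ω : Set (Space (n + 1))) (k₀ : ℝ) (S : Set (Space (n + 1))) : Prop :=
  (μHE[n] : Measure (Space (n + 1))) S < ⊤ ∧ ∃ K : NNReal, ∀ k : ℝ, k₀ ≤ k →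
    ∀ T : Geometry.SimplicialComplex ℝ (Space (n + 1)), IsMesh Ω T → ∀ v ∈ p1Space Ω T,
      ∫⁻ y in S, ENNReal.ofReal (k * ‖v y‖ ^ 2) ∂(μHE[n] : Measure (Space (n + 1))) ≤
        K * ∫⁻ x in Ω, ENNReal.ofReal (k ^ 2 * ‖v x‖ ^ 2 + ‖fderiv ℝ v x‖ ^ 2)

/-- The segment inequality is integrated over the boundary piece and the resulting tube integral is
compared with the volume integral. The direction, length and tube constant come from `Ω` alone,
hence uniformity in the mesh. -/
lemma exists_local_trace_inequality (hΩ : IsOpen Ω) (hbd : Bornology.IsBounded Ω)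
    (hlip : HasLipschitzBoundary Ω) {k₀ : ℝ} (hk₀ : 0 < k₀) {x : Space (n + 1)}
    (hx : x ∈ frontier Ω) :
    ∃ δ > 0, HasTraceInequality Ω k₀ (frontier Ω ∩ Metric.ball x δ) := by
  obtain ⟨e, δ, C, he, hδ, htube, hC⟩ := exists_tube hΩ hlip hx
  refine ⟨δ, hδ, ?_⟩
  set S := frontier Ω ∩ Metric.ball x δ with hS
  have hSm : MeasurableSet S := isClosed_frontier.measurableSet.inter measurableSet_ball
  have hsweep : ∀ f : Space (n + 1) → ENNReal, Measurable f →
      ∫⁻ y in S, (∫⁻ t in Set.Ioc 0 δ, f (y + t • e)) ∂(μHE[n] : Measure (Space (n + 1))) ≤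
        C * ∫⁻ x in Ω, f x := by
    intro f hf
    rw [← lintegral_indicator hΩ.measurableSet]
    refine le_trans (setLIntegral_mono' hSm fun y hy => ?_) (hC _ (hf.indicator hΩ.measurableSet))
    refine le_trans (setLIntegral_mono' measurableSet_Ioc fun t ht => ?_)
      (setLIntegral_le_lintegral (Set.Ioc 0 δ) _)
    rw [Set.indicator_of_mem (htube y hy t ht)]
  refine ⟨?_, C * Real.toNNReal (1 + (δ * k₀)⁻¹), fun k hk T hT v hv => ?_⟩
  -- Sweeping the constant `1` gives `δ` times the surface measure, bounded by a multiple of the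
  -- volume of `Ω`.
  · have h := hsweep (fun _ => 1) measurable_const
    simp only [lintegral_const, Measure.restrict_apply_univ, one_mul, Real.volume_Ioc,
      sub_zero] at h
    refine lt_top_iff_ne_top.2 fun htop => ?_
    rw [htop, ENNReal.mul_top (by simpa using hδ)] at h
    exact (ENNReal.mul_lt_top ENNReal.coe_lt_top hbd.measure_lt_top).not_ge h
  · have hk0 : 0 < k := hk₀.trans_le hk
    have hvm := measurable_of_mem_p1Space hv
    -- Applied to the indicator of the null skeleton, the tube estimate shows that almost every
    -- segment direction line meets it in a null set.
    have hskel : ∀ᵐ y ∂(μHE[n] : Measure (Space (n + 1))).restrict S,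
        volume {t : ℝ | y + t • e ∈ skeleton T} = 0 := by
      have hms := hT.isClosed_skeleton.measurableSet
      have h := hC ((skeleton T).indicator 1) (measurable_one.indicator hms)
      rw [lintegral_indicator_one hms, hT.volume_skeleton, mul_zero, nonpos_iff_eq_zero,
        lintegral_eq_zero_iff] at h
      · filter_upwards [h] with y hy
        refine Eq.trans ?_ hy
        rw [← lintegral_indicator_one]
        · rfl
        · exact hms.preimage (f := fun t : ℝ => y + t • e) (by fun_prop)
      · refine Measurable.lintegral_prod_right' (f := fun q : Space (n + 1) × ℝ =>
          (skeleton T).indicator (1 : Space (n + 1) → ENNReal) (q.1 + q.2 • e)) ?_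
        exact (measurable_one.indicator hms).comp (by fun_prop)
    have hpt : ∀ᵐ y ∂(μHE[n] : Measure (Space (n + 1))).restrict S,
        ENNReal.ofReal (k * ‖v y‖ ^ 2) ≤ ENNReal.ofReal (k / δ) *
          ∫⁻ t in Set.Ioc 0 δ, ENNReal.ofReal (traceDensity δ k v (y + t • e)) := by
      filter_upwards [hskel, ae_restrict_mem hSm] with y hy hyS
      have hseg : ∀ t ∈ Set.Icc 0 δ, y + t • e ∈ closure Ω := by
        intro t ht
        rcases ht.1.eq_or_lt with h0 | h0
        · rw [← h0, zero_smul, add_zero]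
          exact frontier_subset_closure hyS.1
        · exact subset_closure (htube y hyS t ⟨h0, ht.2⟩)
      have h := hT.trace_segment hbd hv he hδ hk0 hseg hy
      calc ENNReal.ofReal (k * ‖v y‖ ^ 2)
          = ENNReal.ofReal (k / δ) * ENNReal.ofReal (δ * ‖v y‖ ^ 2) := by
            rw [← ENNReal.ofReal_mul (by positivity)]
            congr 1
            field_simp
        _ ≤ _ := by gcongr
    have hdens : ∀ x, ENNReal.ofReal (k / δ) * ENNReal.ofReal (traceDensity δ k v x) ≤
        ENNReal.ofReal (1 + (δ * k₀)⁻¹) *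
          ENNReal.ofReal (k ^ 2 * ‖v x‖ ^ 2 + ‖fderiv ℝ v x‖ ^ 2) := by
      intro x
      rw [← ENNReal.ofReal_mul (by positivity), ← ENNReal.ofReal_mul (by positivity)]
      refine ENNReal.ofReal_le_ofReal ?_
      unfold traceDensity
      set a := ‖v x‖ ^ 2 with ha
      set b := ‖fderiv ℝ v x‖ ^ 2 with hb
      have ha0 : 0 ≤ a := sq_nonneg _
      have hb0 : 0 ≤ b := sq_nonneg _
      have h1 : k / δ * (a + δ * (k * a + k⁻¹ * b)) = k / δ * a + (k ^ 2 * a + b) := by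
        field_simp
      -- The only use of `k₀ ≤ k` as a lower bound on frequency: `k / δ ≤ k² / (δ k₀)` absorbs the
      -- lower-order term.
      have h2 : k / δ * a ≤ (δ * k₀)⁻¹ * (k ^ 2 * a) := by
        have h3 : (δ * k₀)⁻¹ * (k ^ 2 * a) = k / δ * a * (k / k₀) := by
          field_simp
        rw [h3]
        exact le_mul_of_one_le_right (by positivity) ((one_le_div hk₀).2 hk)
      rw [h1]
      nlinarith [mul_nonneg (by positivity : 0 ≤ (δ * k₀)⁻¹) hb0]
    have hm := (measurable_traceDensity (δ := δ) (k := k) hvm).ennreal_ofReal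
    have hm2 := measurable_fderiv ℝ v
    calc ∫⁻ y in S, ENNReal.ofReal (k * ‖v y‖ ^ 2) ∂(μHE[n] : Measure (Space (n + 1)))
        ≤ ∫⁻ y in S, (ENNReal.ofReal (k / δ) * ∫⁻ t in Set.Ioc 0 δ,
            ENNReal.ofReal (traceDensity δ k v (y + t • e)))
              ∂(μHE[n] : Measure (Space (n + 1))) := lintegral_mono_ae hpt
      _ ≤ ENNReal.ofReal (k / δ) * (C * ∫⁻ x in Ω, ENNReal.ofReal (traceDensity δ k v x)) := by
          rw [lintegral_const_mul' _ _ ENNReal.ofReal_ne_top]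
          gcongr
          exact hsweep _ hm
      _ = C * ∫⁻ x in Ω, ENNReal.ofReal (k / δ) * ENNReal.ofReal (traceDensity δ k v x) := by
          rw [lintegral_const_mul' _ _ ENNReal.ofReal_ne_top]
          ring
      _ ≤ C * ∫⁻ x in Ω, ENNReal.ofReal (1 + (δ * k₀)⁻¹) *
            ENNReal.ofReal (k ^ 2 * ‖v x‖ ^ 2 + ‖fderiv ℝ v x‖ ^ 2) := by
          exact mul_le_mul_right (lintegral_mono hdens) _
      _ = _ := by
          rw [lintegral_const_mul' _ _ ENNReal.ofReal_ne_top, ENNReal.coe_mul, mul_assoc]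
          rfl

/-- Compactness of the boundary: the property passes to subsets and to finite unions, with constants
adding. -/
lemma exists_trace_inequality (hΩ : IsOpen Ω) (hbd : Bornology.IsBounded Ω)
    (hlip : HasLipschitzBoundary Ω) {k₀ : ℝ} (hk₀ : 0 < k₀) :
    HasTraceInequality Ω k₀ (frontier Ω) := by
  have hcomp : IsCompact (frontier Ω) :=
    hbd.isCompact_closure.of_isClosed_subset isClosed_frontier frontier_subset_closure
  refine hcomp.induction_on (p := HasTraceInequality Ω k₀) ?_ ?_ ?_ ?_
  · exact ⟨by simp, 0, by simp⟩
  · rintro s t hst ⟨ht, K, hK⟩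
    exact ⟨(measure_mono hst).trans_lt ht, K, fun k hk T hT v hv =>
      (lintegral_mono_set hst).trans (hK k hk T hT v hv)⟩
  · rintro s t ⟨hs, K, hK⟩ ⟨ht, K', hK'⟩
    refine ⟨measure_union_lt_top hs ht, K + K', fun k hk T hT v hv => ?_⟩
    refine (lintegral_union_le _ _ _).trans ?_
    rw [ENNReal.coe_add, add_mul]
    exact add_le_add (hK k hk T hT v hv) (hK' k hk T hT v hv)
  · intro x hx
    obtain ⟨δ, hδ, h⟩ := exists_local_trace_inequality hΩ hbd hlip hk₀ hx
    exact ⟨_, Filter.inter_mem self_mem_nhdsWithin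
      (mem_nhdsWithin_of_mem_nhds (Metric.ball_mem_nhds x hδ)), h⟩

end Trace

/-! ### Inner products and norms in `L²` -/

section L2

open MeasureTheory

variable {X E : Type*} [MeasurableSpace X] {μ : Measure X} [NormedAddCommGroup E]
  [InnerProductSpace ℂ E]

lemma inner_toLp {f g : X → E} (hf : MemLp f 2 μ) (hg : MemLp g 2 μ) :
    inner ℂ (hf.toLp f) (hg.toLp g) = ∫ x, inner ℂ (f x) (g x) ∂μ := by
  rw [L2.inner_def]
  refine integral_congr_ae ?_
  filter_upwards [hf.coeFn_toLp, hg.coeFn_toLp] with x hx hy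
  rw [hx, hy]

lemma norm_toLp_sq {f : X → E} (hf : MemLp f 2 μ) : ‖hf.toLp f‖ ^ 2 = ∫ x, ‖f x‖ ^ 2 ∂μ := by
  have h := inner_toLp hf hf
  simp only [inner_self_eq_norm_sq_to_K] at h
  have h2 : ∫ x, ((‖f x‖ : ℂ)) ^ 2 ∂μ = ((∫ x, ‖f x‖ ^ 2 ∂μ : ℝ) : ℂ) := by
    rw [← integral_complex_ofReal]
    simp
  refine Complex.ofReal_injective (Eq.trans ?_ (h.trans h2))
  simp

lemma integrable_norm_sq {X E : Type*} [MeasurableSpace X] {μ : Measure X}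
    [NormedAddCommGroup E] {f : X → E} (hf : MemLp f 2 μ) : Integrable (fun x => ‖f x‖ ^ 2) μ :=
  (memLp_two_iff_integrable_sq_norm hf.1).1 hf

end L2

/-! ### The Helmholtz energies as `L²` inner products -/

section FormMaps

open MeasureTheory

variable {d : ℕ} {Ω : Set (Space d)} {T : Geometry.SimplicialComplex ℝ (Space d)}

/-- The gradient of a complex-valued function. -/
noncomputable def gradField (v : Space d → ℂ) (x : Space d) : EuclideanSpace ℂ (Fin d) :=
  WithLp.toLp 2 fun i => fderiv ℝ v x (EuclideanSpace.single i 1)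

lemma norm_gradField_sq (v : Space d → ℂ) (x : Space d) :
    ‖gradField v x‖ ^ 2 = ∑ i, ‖fderiv ℝ v x (EuclideanSpace.single i 1)‖ ^ 2 := by
  rw [EuclideanSpace.norm_sq_eq]
  rfl

lemma norm_fderiv_le_norm_gradField (v : Space d → ℂ) (x : Space d) :
    ‖fderiv ℝ v x‖ ≤ ‖gradField v x‖ := by
  refine ContinuousLinearMap.opNorm_le_bound _ (norm_nonneg _) fun y => ?_
  have hy : y = ∑ i, y i • EuclideanSpace.single i (1 : ℝ) := by
    have := (EuclideanSpace.basisFun (Fin d) ℝ).sum_repr y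
    simpa using this.symm
  have h1 : ‖fderiv ℝ v x y‖ ≤ ∑ i, ‖fderiv ℝ v x (EuclideanSpace.single i 1)‖ * ‖y i‖ := by
    conv_lhs => rw [hy, map_sum]
    refine (norm_sum_le _ _).trans (Finset.sum_le_sum fun i _ => ?_)
    rw [map_smul, norm_smul, mul_comm]
  refine h1.trans (abs_le_of_sq_le_sq' ?_ (by positivity)).2
  rw [mul_pow, norm_gradField_sq, EuclideanSpace.norm_sq_eq]
  exact Finset.sum_mul_sq_le_sq_mul_sq _ _ _

lemma measurable_gradField (v : Space d → ℂ) : Measurable (gradField v) := by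
  refine (WithLp.measurable_toLp 2 _).comp (measurable_pi_lambda _ fun i => ?_)
  exact measurable_fderiv_apply_const ℝ v _

lemma norm_gradField_sq_le (v : Space d → ℂ) (x : Space d) :
    ‖gradField v x‖ ^ 2 ≤ d * ‖fderiv ℝ v x‖ ^ 2 := by
  rw [norm_gradField_sq]
  calc ∑ i : Fin d, ‖fderiv ℝ v x (EuclideanSpace.single i 1)‖ ^ 2
      ≤ ∑ _i : Fin d, ‖fderiv ℝ v x‖ ^ 2 := by
        refine Finset.sum_le_sum fun i _ => ?_
        gcongr
        simpa using (fderiv ℝ v x).le_opNorm (EuclideanSpace.single i 1)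
    _ = _ := by simp

lemma IsMesh.ae_restrict (hT : IsMesh Ω T) (hΩ : IsOpen Ω) :
    ∀ᵐ x ∂volume.restrict Ω, x ∈ closure Ω ∧ x ∉ skeleton T := by
  filter_upwards [ae_restrict_mem hΩ.measurableSet, ae_restrict_of_ae hT.ae_notMem_skeleton]
    with x hx hxs using ⟨subset_closure hx, hxs⟩

lemma memLp_gradField (hΩ : IsOpen Ω) (hbd : Bornology.IsBounded Ω) (hT : IsMesh Ω T)
    {v : Space d → ℂ} (hv : v ∈ p1Space Ω T) : MemLp (gradField v) 2 (volume.restrict Ω) := by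
  have : IsFiniteMeasure (volume.restrict Ω) := ⟨by simpa using hbd.measure_lt_top⟩
  obtain ⟨K, hK⟩ := hT.exists_fderiv_bound hv
  refine MemLp.of_bound (measurable_gradField v).aestronglyMeasurable √(d * K ^ 2) ?_
  filter_upwards [hT.ae_restrict hΩ] with x hx
  refine Real.le_sqrt_of_sq_le ((norm_gradField_sq_le v x).trans ?_)
  gcongr
  exact hK x hx.1 hx.2

lemma memLp_of_mem_p1Space (hbd : Bornology.IsBounded Ω) {μ : Measure (Space d)}
    [IsFiniteMeasure μ] (hμ : ∀ᵐ x ∂μ, x ∈ closure Ω) {v : Space d → ℂ}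
    (hv : v ∈ p1Space Ω T) : MemLp v 2 μ := by
  obtain ⟨K, hK⟩ := exists_bound hbd hv
  refine MemLp.of_bound (measurable_of_mem_p1Space hv).aestronglyMeasurable K ?_
  filter_upwards [hμ] with x hx using hK x hx

/-- A `P1` function as an element of `L²(μ)`. -/
noncomputable def valueMap {μ : Measure (Space d)} (h : ∀ v ∈ p1Space Ω T, MemLp v 2 μ) :
    p1Space Ω T →ₗ[ℂ] Lp ℂ 2 μ where
  toFun v := (h v v.2).toLp v
  map_add' u v := (h u u.2).toLp_add (h v v.2)
  map_smul' c v := (h v v.2).toLp_const_smul c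

/-- The gradient of a `P1` function as an element of `L²(Ω)`. -/
noncomputable def gradMap (hΩ : IsOpen Ω) (hbd : Bornology.IsBounded Ω) (hT : IsMesh Ω T) :
    p1Space Ω T →ₗ[ℂ] Lp (EuclideanSpace ℂ (Fin d)) 2 (volume.restrict Ω) where
  toFun v := (memLp_gradField hΩ hbd hT v.2).toLp (gradField v)
  map_add' u v := by
    rw [← MemLp.toLp_add]
    refine MemLp.toLp_congr _ _ ?_
    filter_upwards [hT.ae_restrict hΩ] with x hx
    ext i
    simp [gradField, fderiv_add (hT.differentiableAt u.2 hx.1 hx.2)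
      (hT.differentiableAt v.2 hx.1 hx.2)]
  map_smul' c v := by
    rw [RingHom.id_apply, ← MemLp.toLp_const_smul]
    refine MemLp.toLp_congr _ _ ?_
    filter_upwards [hT.ae_restrict hΩ] with x hx
    ext i
    simp [gradField, fderiv_const_smul (hT.differentiableAt v.2 hx.1 hx.2)]

lemma inner_valueMap {μ : Measure (Space d)} (h : ∀ v ∈ p1Space Ω T, MemLp v 2 μ)
    (u v : p1Space Ω T) :
    inner ℂ (valueMap h v) (valueMap h u) = ∫ x, (u : Space d → ℂ) x * conj (v.1 x) ∂μ :=
  inner_toLp (h v v.2) (h u u.2)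

lemma inner_gradMap (hΩ : IsOpen Ω) (hbd : Bornology.IsBounded Ω) (hT : IsMesh Ω T)
    (u v : p1Space Ω T) :
    inner ℂ (gradMap hΩ hbd hT v) (gradMap hΩ hbd hT u) = gradInner Ω u v := by
  refine (inner_toLp (memLp_gradField hΩ hbd hT v.2) (memLp_gradField hΩ hbd hT u.2)).trans ?_
  simp only [PiLp.inner_apply, RCLike.inner_apply]
  rfl

/-- `v ↦ (∇v, k v)`, an isometry for the weighted norm. -/
noncomputable def energyMap (hΩ : IsOpen Ω) (hbd : Bornology.IsBounded Ω) (hT : IsMesh Ω T)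
    (h : ∀ v ∈ p1Space Ω T, MemLp v 2 (volume.restrict Ω)) (k : ℝ) :
    p1Space Ω T →ₗ[ℂ] WithLp 2 (Lp (EuclideanSpace ℂ (Fin d)) 2 (volume.restrict Ω) ×
      Lp ℂ 2 (volume.restrict Ω)) :=
  (WithLp.linearEquiv 2 ℂ _).symm.toLinearMap.comp
    ((gradMap hΩ hbd hT).prod ((k : ℂ) • valueMap h))

variable {hΩ : IsOpen Ω} {hbd : Bornology.IsBounded Ω} {hT : IsMesh Ω T}
  {h : ∀ v ∈ p1Space Ω T, MemLp v 2 (volume.restrict Ω)} {k : ℝ}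

lemma energyMap_apply (v : p1Space Ω T) : energyMap hΩ hbd hT h k v =
    WithLp.toLp 2 (gradMap hΩ hbd hT v, (k : ℂ) • valueMap h v) := rfl

lemma norm_energyMap_sq (v : p1Space Ω T) :
    ‖energyMap hΩ hbd hT h k v‖ ^ 2 = ‖gradMap hΩ hbd hT v‖ ^ 2 + k ^ 2 * ‖valueMap h v‖ ^ 2 := by
  have hk : ‖(k : ℂ) • valueMap h v‖ ^ 2 = k ^ 2 * ‖valueMap h v‖ ^ 2 := by
    rw [norm_smul, mul_pow, Complex.norm_real, Real.norm_eq_abs, sq_abs]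
  rw [← hk]
  exact WithLp.prod_norm_sq_eq_of_L2 _

lemma inner_energyMap (u v : p1Space Ω T) :
    inner ℂ (energyMap hΩ hbd hT h k v) (energyMap hΩ hbd hT h k u) = weightedInner Ω k u v := by
  rw [WithLp.prod_inner_apply, weightedInner, ← inner_gradMap hΩ hbd hT u v, l2Inner,
    ← inner_valueMap h u v]
  rw [energyMap_apply, energyMap_apply, inner_smul_left, inner_smul_right, Complex.conj_ofReal]
  ring

lemma weightedNorm_eq (v : p1Space Ω T) :
    weightedNorm Ω k v = ‖energyMap hΩ hbd hT h k v‖ := by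
  have h1 := inner_energyMap (hΩ := hΩ) (hbd := hbd) (hT := hT) (h := h) (k := k) v v
  rw [inner_self_eq_norm_sq_to_K] at h1
  rw [weightedNorm, ← h1]
  norm_cast
  exact Real.sqrt_sq (norm_nonneg _)

/-- The value component alone suffices: a function vanishing almost everywhere on `Ω` vanishes on
`closure Ω` by continuity, and outside by the convention for `P1` functions. -/
lemma energyMap_injective (hk : 0 < k) : Function.Injective (energyMap hΩ hbd hT h k) := by
  rw [← LinearMap.ker_eq_bot, LinearMap.ker_eq_bot']
  intro v hv
  have h1 := norm_energyMap_sq (hΩ := hΩ) (hbd := hbd) (hT := hT) (h := h) (k := k) v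
  rw [hv, norm_zero] at h1
  have h2 : ‖valueMap h v‖ ^ 2 = 0 := by
    have := sq_nonneg ‖gradMap hΩ hbd hT v‖
    have h3 := sq_nonneg ‖valueMap h v‖
    have h4 : k ^ 2 * ‖valueMap h v‖ ^ 2 = 0 := by nlinarith [mul_nonneg (sq_nonneg k) h3]
    exact (mul_eq_zero.1 h4).resolve_left (by positivity)
  have h3 : valueMap h v = 0 := by simpa using h2
  have h4 : v.1 =ᵐ[volume.restrict Ω] 0 := by
    have := (h v v.2).coeFn_toLp
    refine this.symm.trans ?_
    rw [show (h v v.2).toLp v.1 = 0 from h3]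
    exact Lp.coeFn_zero _ _ _
  have h5 : Set.EqOn v.1 0 Ω :=
    Measure.eqOn_open_of_ae_eq h4 hΩ (v.2.1.mono subset_closure) continuousOn_const
  refine Subtype.ext (funext fun x => ?_)
  by_cases hx : x ∈ closure Ω
  · exact h5.of_subset_closure v.2.1 continuousOn_const subset_closure subset_rfl hx
  · exact v.2.2.1 x hx

lemma weightedInner_eq_zero_of_disjoint {N : ℕ} {Ωt : Fin N → Set (Space d)}
    (hT : IsMesh Ω T) (hcov : IsSubdomainCover Ω T Ωt) {i j : Fin N}
    (hij : j ∉ neighbours Ω Ωt i) {u v : Space d → ℂ}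
    (hu : u ∈ localSpace Ω T (subdomain Ω Ωt i)) (hv : v ∈ localSpace Ω T (subdomain Ω Ωt j))
    (k : ℝ) : weightedInner Ω k v u = 0 := by
  have hae : ∀ᵐ x ∂volume.restrict Ω,
      x ∉ closure (subdomain Ω Ωt i) ∨ x ∉ closure (subdomain Ω Ωt j) := by
    filter_upwards [ae_restrict_of_ae (measure_eq_zero_iff_ae_notMem.1
      (volume_overlap_eq_zero hT hcov hij))] with x hx
    rwa [Set.mem_inter_iff, not_and_or] at hx
  have h1 : gradInner Ω v u = 0 := by
    refine integral_eq_zero_of_ae ?_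
    filter_upwards [hae] with x hx
    rcases hx with hx | hx
    · simp [(eq_zero_of_mem_localSpace hu hx).2]
    · simp [(eq_zero_of_mem_localSpace hv hx).2]
  have h2 : l2Inner Ω v u = 0 := by
    refine integral_eq_zero_of_ae ?_
    filter_upwards [hae] with x hx
    rcases hx with hx | hx
    · simp [(eq_zero_of_mem_localSpace hu hx).1]
    · simp [(eq_zero_of_mem_localSpace hv hx).1]
  simp [weightedInner, h1, h2]

/-- The trace inequality in terms of `L²` norms. -/
lemma HasTraceInequality.norm_sq_le {n : ℕ} {Ω : Set (Space (n + 1))}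
    {T : Geometry.SimplicialComplex ℝ (Space (n + 1))} {hΩ : IsOpen Ω}
    {hbd : Bornology.IsBounded Ω} {hT : IsMesh Ω T}
    {h : ∀ v ∈ p1Space Ω T, MemLp v 2 (volume.restrict Ω)}
    {hb : ∀ v ∈ p1Space Ω T, MemLp v 2 ((μHE[n] : Measure (Space (n + 1))).restrict (frontier Ω))}
    {K : NNReal} {k : ℝ} (hk : 0 ≤ k)
    (htr : ∀ v ∈ p1Space Ω T,
      ∫⁻ y in frontier Ω, ENNReal.ofReal (k * ‖v y‖ ^ 2) ∂(μHE[n] : Measure (Space (n + 1))) ≤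
        K * ∫⁻ x in Ω, ENNReal.ofReal (k ^ 2 * ‖v x‖ ^ 2 + ‖fderiv ℝ v x‖ ^ 2))
    (v : p1Space Ω T) :
    k * ‖valueMap hb v‖ ^ 2 ≤ K * ‖energyMap hΩ hbd hT h k v‖ ^ 2 := by
  have hL : ‖valueMap h v‖ ^ 2 = ∫ x in Ω, ‖v.1 x‖ ^ 2 := norm_toLp_sq (h v v.2)
  have hG : ‖gradMap hΩ hbd hT v‖ ^ 2 = ∫ x in Ω, ‖gradField v.1 x‖ ^ 2 :=
    norm_toLp_sq (memLp_gradField hΩ hbd hT v.2)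
  have hB : ‖valueMap hb v‖ ^ 2 = ∫ x in frontier Ω, ‖v.1 x‖ ^ 2
    ∂(μHE[n] : Measure (Space (n + 1))) := norm_toLp_sq (hb v v.2)
  have iL := (integrable_norm_sq (h v v.2)).const_mul (k ^ 2)
  have iG := integrable_norm_sq (memLp_gradField hΩ hbd hT v.2)
  have iB := (integrable_norm_sq (hb v v.2)).const_mul k
  have iE : Integrable (fun x => k ^ 2 * ‖v.1 x‖ ^ 2 + ‖gradField v.1 x‖ ^ 2)
      (volume.restrict Ω) := iL.add iG
  have hE : ‖energyMap hΩ hbd hT h k v‖ ^ 2 =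
      ∫ x in Ω, (k ^ 2 * ‖v.1 x‖ ^ 2 + ‖gradField v.1 x‖ ^ 2) := by
    rw [norm_energyMap_sq, hL, hG, integral_add iL iG, integral_const_mul, add_comm]
  rw [hE, hB, ← integral_const_mul]
  refine (ENNReal.ofReal_le_ofReal_iff (mul_nonneg K.coe_nonneg
    (integral_nonneg fun x => by positivity))).1 ?_
  rw [ENNReal.ofReal_mul K.coe_nonneg, ENNReal.ofReal_coe_nnreal,
    ofReal_integral_eq_lintegral_ofReal iB (ae_of_all _ fun x => by positivity),
    ofReal_integral_eq_lintegral_ofReal iE (ae_of_all _ fun x => by positivity)]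
  refine (htr v v.2).trans ?_
  gcongr with x
  exact norm_fderiv_le_norm_gradField _ _

end FormMaps

/-! ### Boundedness and coercivity of the abstract Helmholtz form -/

section HelmholtzForm

variable {V H₁ H₂ H₃ : Type*} [AddCommGroup V] [Module ℂ V] [NormedAddCommGroup H₁]
  [InnerProductSpace ℂ H₁] [NormedAddCommGroup H₂] [InnerProductSpace ℂ H₂]
  [NormedAddCommGroup H₃] [InnerProductSpace ℂ H₃]

/-- The sesquilinear form `a_ε` in terms of the maps to the gradient, the values and the boundary
values. -/
noncomputable def helmholtzForm (G : V →ₗ[ℂ] H₁) (L : V →ₗ[ℂ] H₂) (B : V →ₗ[ℂ] H₃) (k ε : ℝ)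
    (η : ℂ) : V →ₗ[ℂ] V →ₗ⋆[ℂ] ℂ :=
  inducedForm G - ((k : ℂ) ^ 2 + Complex.I * ε) • inducedForm L -
    (Complex.I * η) • inducedForm B

variable {G : V →ₗ[ℂ] H₁} {L : V →ₗ[ℂ] H₂} {B : V →ₗ[ℂ] H₃} {k ε : ℝ} {η : ℂ}

lemma helmholtzForm_apply (u v : V) : helmholtzForm G L B k ε η u v =
    inner ℂ (G v) (G u) - ((k : ℂ) ^ 2 + Complex.I * ε) * inner ℂ (L v) (L u) -
      Complex.I * η * inner ℂ (B v) (B u) := by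
  simp [helmholtzForm]

/-- Cauchy–Schwarz on each term: the gradient contributes `1`, the mass term `1 + Cε`, and the
boundary term `Cη * K` through the trace inequality, whose factor `k` matches `‖η‖ ≤ Cη * k`. -/
lemma helmholtzForm_bounded {Cε Cη K : ℝ} (hk : 0 < k) (hε : |ε| ≤ Cε * k ^ 2)
    (hη : ‖η‖ ≤ Cη * k) (N : V → ℝ) (hN : ∀ v, 0 ≤ N v)
    (hE : ∀ v, N v ^ 2 = ‖G v‖ ^ 2 + k ^ 2 * ‖L v‖ ^ 2)
    (hB : ∀ v, k * ‖B v‖ ^ 2 ≤ K * N v ^ 2) (hK : 0 ≤ K) (u v : V) :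
    ‖helmholtzForm G L B k ε η u v‖ ≤ (2 + Cε + Cη * K) * N u * N v := by
  have hCη : 0 ≤ Cη := nonneg_of_mul_nonneg_left ((norm_nonneg η).trans hη) hk
  have hCε : 0 ≤ Cε := nonneg_of_mul_nonneg_left ((abs_nonneg ε).trans hε) (by positivity)
  have hG : ∀ v, ‖G v‖ ≤ N v := fun v => by
    refine (abs_le_of_sq_le_sq' ?_ (hN v)).2
    rw [hE]
    exact le_add_of_nonneg_right (by positivity)
  have hL : ∀ v, k * ‖L v‖ ≤ N v := fun v => by
    refine (abs_le_of_sq_le_sq' ?_ (hN v)).2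
    rw [hE, mul_pow]
    exact le_add_of_nonneg_left (by positivity)
  have hBuv : k * (‖B u‖ * ‖B v‖) ≤ K * (N u * N v) := by
    refine (abs_le_of_sq_le_sq' ?_ (by have := hN u; have := hN v; positivity)).2
    calc (k * (‖B u‖ * ‖B v‖)) ^ 2 = (k * ‖B u‖ ^ 2) * (k * ‖B v‖ ^ 2) := by ring
      _ ≤ (K * N u ^ 2) * (K * N v ^ 2) :=
        mul_le_mul (hB u) (hB v) (by positivity) (mul_nonneg hK (sq_nonneg _))
      _ = _ := by ring
  have h1 : ‖inner ℂ (G v) (G u)‖ ≤ N u * N v := by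
    rw [mul_comm]
    exact (norm_inner_le_norm _ _).trans (mul_le_mul (hG v) (hG u) (norm_nonneg _) (hN v))
  have h2 : ‖((k : ℂ) ^ 2 + Complex.I * ε) * inner ℂ (L v) (L u)‖ ≤ (1 + Cε) * (N u * N v) := by
    rw [norm_mul]
    calc _ ≤ ((1 + Cε) * k ^ 2) * (‖L v‖ * ‖L u‖) := by
          gcongr
          · exact norm_shift_le hε
          · exact norm_inner_le_norm _ _
      _ = (1 + Cε) * ((k * ‖L u‖) * (k * ‖L v‖)) := by ring
      _ ≤ _ := by gcongr <;> apply_rules [hL, hN]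
  have h3 : ‖Complex.I * η * inner ℂ (B v) (B u)‖ ≤ Cη * (K * (N u * N v)) := by
    rw [norm_mul, norm_mul, Complex.norm_I, one_mul]
    calc _ ≤ (Cη * k) * (‖B v‖ * ‖B u‖) := by
          gcongr
          exact norm_inner_le_norm _ _
      _ = Cη * (k * (‖B u‖ * ‖B v‖)) := by ring
      _ ≤ _ := by gcongr
  rw [helmholtzForm_apply]
  calc _ ≤ N u * N v + (1 + Cε) * (N u * N v) + Cη * (K * (N u * N v)) :=
        (norm_sub_le _ _).trans (add_le_add ((norm_sub_le _ _).trans (add_le_add h1 h2)) h3)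
    _ = _ := by ring

lemma helmholtzForm_coercive {Cε : ℝ} (hε0 : ε ≠ 0) (hε : |ε| ≤ Cε * k ^ 2)
    (hη : 0 ≤ (conj (wavenumber k ε) * η).re) (v : V) :
    |ε| / (2 * (1 + Cε) * k ^ 2) * (‖G v‖ ^ 2 + k ^ 2 * ‖L v‖ ^ 2) ≤
      (Complex.I * conj (wavenumber k ε) / ‖wavenumber k ε‖ *
        helmholtzForm G L B k ε η v v).re := by
  refine (helmholtz_coercive hε0 hε hη (sq_nonneg ‖G v‖) (sq_nonneg ‖L v‖)
    (sq_nonneg ‖B v‖)).trans (le_of_eq ?_)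
  simp only [helmholtzForm_apply, inner_self_eq_norm_sq_to_K, Complex.ofReal_pow,
    Complex.coe_algebraMap]

end HelmholtzForm

/-! ### The Schwarz bound -/

open MeasureTheory

/-- A variational problem on a subspace `W` of functions, seen inside a larger function space. -/
lemma existsUnique_isProjection {d : ℕ} {Ω : Set (Space d)} {k ε : ℝ} {η : ℂ}
    {P W : Submodule ℂ (Space d → ℂ)} (hW : W ≤ P) {a : P →ₗ[ℂ] P →ₗ⋆[ℂ] ℂ}
    (ha : ∀ u v : P, form Ω k ε η u v = a u v) (v : P)
    (h : ∃! u, u ∈ W.comap P.subtype ∧ ∀ w ∈ W.comap P.subtype, a u w = a v w) :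
    ∃! u, IsProjection Ω k ε η W v u := by
  obtain ⟨u, ⟨hu, huw⟩, huniq⟩ := h
  refine ⟨u, ⟨hu, fun w hw => ?_⟩, fun u' ⟨hu', huw'⟩ => ?_⟩
  · have := huw ⟨w, hW hw⟩ hw
    rwa [← ha, ← ha] at this
  · refine congrArg Subtype.val (huniq ⟨u', hW hu'⟩ ⟨hu', fun w hw => ?_⟩)
    rw [← ha, ← ha]
    exact huw' w hw

/-- The Schwarz bound for a bounded and coercive form. -/
lemma schwarz_bound_of_coercive {d N M : ℕ} {Ω : Set (Space d)} {k ε : ℝ} {η : ℂ}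
    {P : Submodule ℂ (Space d → ℂ)} [FiniteDimensional ℂ P] {H : Type*} [NormedAddCommGroup H]
    [InnerProductSpace ℂ H] {a : P →ₗ[ℂ] P →ₗ⋆[ℂ] ℂ} {T : P →ₗ[ℂ] H} {θ : ℂ} {A c : ℝ}
    (hform : ∀ u v : P, form Ω k ε η u v = a u v) (hnorm : ∀ v : P, weightedNorm Ω k v = ‖T v‖)
    (hinner : ∀ u v : P, inner ℂ (T v) (T u) = weightedInner Ω k u v)
    (hT : Function.Injective T) (hbdd : ∀ u v, ‖a u v‖ ≤ A * ‖T u‖ * ‖T v‖)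
    (hθ : ‖θ‖ ≤ 1) (hA : 0 ≤ A) (hc : 0 < c) (hcoer : ∀ v, c * ‖T v‖ ^ 2 ≤ (θ * a v v).re)
    {W : Fin (N + 1) → Submodule ℂ (Space d → ℂ)} (hW : ∀ ℓ, W ℓ ≤ P) (nb : Fin N → Set (Fin N))
    (hsymm : ∀ i j, j ∈ nb i → i ∈ nb j) (hM : ∀ i, (nb i).ncard ≤ M)
    (horth : ∀ i j, j ∉ nb i → ∀ u ∈ W i.succ, ∀ v ∈ W j.succ, weightedInner Ω k v u = 0)
    (v : P) :
    (∀ ℓ, ∃! u, IsProjection Ω k ε η (W ℓ) v u) ∧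
      c * weightedNorm Ω k (∑ ℓ, proj Ω k ε η (W ℓ) v) ≤
        (1 + M) * A * weightedNorm Ω k v := by
  have hex : ∀ ℓ, ∃! u, IsProjection Ω k ε η (W ℓ) v u := fun ℓ =>
    existsUnique_isProjection (hW ℓ) hform v (existsUnique_galerkin hT hc hcoer _ _)
  refine ⟨hex, ?_⟩
  -- Existence is what makes the value chosen by `Classical.epsilon` in `proj` a genuine solution.
  have hproj : ∀ ℓ, IsProjection Ω k ε η (W ℓ) v (proj Ω k ε η (W ℓ) v) := fun ℓ =>
    Classical.epsilon_spec (hex ℓ).exists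
  let q : Fin (N + 1) → P := fun ℓ => ⟨_, hW ℓ (hproj ℓ).1⟩
  have hq : ∀ ℓ, a (q ℓ) (q ℓ) = a v (q ℓ) := fun ℓ => by
    rw [← hform, ← hform]
    exact (hproj ℓ).2 _ (hproj ℓ).1
  have h0 : c * ‖T (q 0)‖ ≤ A * ‖T v‖ := norm_galerkin_le hbdd hθ hA hcoer (hq 0)
  have h1 : c * ‖T (∑ i : Fin N, q i.succ)‖ ≤ A * M * ‖T v‖ := by
    refine norm_sum_galerkin_le hbdd hθ hA hc.le hcoer (fun i : Fin N => q i.succ) _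
      (fun i => hq i.succ) nb hsymm hM fun i j hij => ?_
    rw [hinner]
    exact horth i j hij _ (hproj i.succ).1 _ (hproj j.succ).1
  have hsum : ∑ ℓ, proj Ω k ε η (W ℓ) v = (q 0 + ∑ i : Fin N, q i.succ : P) := by
    rw [← Fin.sum_univ_succ, Submodule.coe_sum]
  rw [hsum, hnorm, hnorm, map_add]
  calc _ ≤ c * (‖T (q 0)‖ + ‖T (∑ i : Fin N, q i.succ)‖) := by gcongr; exact norm_add_le _ _
    _ ≤ _ := by linarith

lemma schwarz_bound {n : ℕ} {Ω : Set (Space (n + 1))} (hΩ : IsLipschitzPolyhedron Ω)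
    (Cε Cη k₀ : ℝ) (hk₀ : 0 < k₀) (M : ℕ) :
    ∃ C : ℝ, 0 < C ∧
      ∀ (k ε : ℝ) (η : ℂ), k₀ ≤ k → 0 < |ε| → |ε| ≤ Cε * k ^ 2 → ‖η‖ ≤ Cη * k →
        0 ≤ (conj (wavenumber k ε) * η).re →
      ∀ Th TH : Geometry.SimplicialComplex ℝ (Space (n + 1)), IsMesh Ω Th → IsMesh Ω TH →
        (∀ s ∈ elements TH,
          IsUnionOfElements Th (convexHull ℝ (s : Set (Space (n + 1))))) →
      ∀ (N : ℕ) (Ωt : Fin N → Set (Space (n + 1))), IsSubdomainCover Ω Th Ωt →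
        (∀ ℓ, (neighbours Ω Ωt ℓ).ncard ≤ M) →
      ∀ v ∈ p1Space Ω Th,
        (∀ ℓ : Fin (N + 1), ∃! u, IsProjection Ω k ε η (schwarzSpace Ω Th TH Ωt ℓ) v u) ∧
        weightedNorm Ω k (schwarzOp Ω k ε η Th TH Ωt v) ≤
          C * (k ^ 2 / |ε|) * weightedNorm Ω k v := by
  obtain ⟨hfin, K, hK⟩ := exists_trace_inequality hΩ.isOpen hΩ.isBounded hΩ.lipschitz hk₀
  -- The factor `1 + M` counts the coarse and local parts, the middle factor is the continuity
  -- constant `A`, and the last is what `c⁻¹` leaves besides `k² / |ε|`. Absolute values keep the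
  -- constant positive when `Cε` or `Cη` is negative.
  refine ⟨(1 + M) * (2 + |Cε| + |Cη| * K) * (2 * (1 + |Cε|)), by positivity, ?_⟩
  intro k ε η hk hε0 hε hη hzη Th TH hTh hTH hsub N Ωt hcov hM v hv
  have hk0 : 0 < k := hk₀.trans_le hk
  have hε' : |ε| ≤ |Cε| * k ^ 2 := hε.trans (by gcongr; exact le_abs_self _)
  have hη' : ‖η‖ ≤ |Cη| * k := hη.trans (by gcongr; exact le_abs_self _)
  have hεne : ε ≠ 0 := abs_pos.1 hε0
  have : IsFiniteMeasure (volume.restrict Ω) := ⟨by simpa using hΩ.isBounded.measure_lt_top⟩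
  have : IsFiniteMeasure ((μHE[n] : Measure (Space (n + 1))).restrict (frontier Ω)) :=
    ⟨by simpa using hfin⟩
  have hL : ∀ v ∈ p1Space Ω Th, MemLp v 2 (volume.restrict Ω) := fun v hv =>
    memLp_of_mem_p1Space hΩ.isBounded ((hTh.ae_restrict hΩ.isOpen).mono fun _ hx => hx.1) hv
  have hB : ∀ v ∈ p1Space Ω Th,
      MemLp v 2 ((μHE[n] : Measure (Space (n + 1))).restrict (frontier Ω)) := fun v hv =>
    memLp_of_mem_p1Space hΩ.isBounded ((ae_restrict_mem isClosed_frontier.measurableSet).mono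
      fun _ hx => frontier_subset_closure hx) hv
  let T := energyMap hΩ.isOpen hΩ.isBounded hTh hL k
  let a := helmholtzForm (gradMap hΩ.isOpen hΩ.isBounded hTh) (valueMap hL) (valueMap hB) k ε η
  let θ : ℂ := Complex.I * conj (wavenumber k ε) / ‖wavenumber k ε‖
  let A : ℝ := 2 + |Cε| + |Cη| * K
  let c : ℝ := |ε| / (2 * (1 + |Cε|) * k ^ 2)
  have hc : 0 < c := by positivity
  have hA : 0 ≤ A := by positivity
  have hform : ∀ u v : p1Space Ω Th, form Ω k ε η u v = a u v := fun u v => by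
    rw [helmholtzForm_apply, inner_gradMap, inner_valueMap, inner_valueMap]
    rfl
  have hθ : ‖θ‖ ≤ 1 := by
    simp only [θ, norm_div, norm_mul, Complex.norm_I, one_mul, RCLike.norm_conj,
      Complex.norm_real, norm_norm]
    exact div_self_le_one _
  have hcoer : ∀ v, c * ‖T v‖ ^ 2 ≤ (θ * a v v).re := fun v => by
    rw [norm_energyMap_sq]
    exact helmholtzForm_coercive hεne hε' hzη v
  have hbdd : ∀ u v, ‖a u v‖ ≤ A * ‖T u‖ * ‖T v‖ :=
    helmholtzForm_bounded hk0 hε' hη' (fun v => ‖T v‖) (fun v => norm_nonneg _)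
      (fun v => norm_energyMap_sq v)
      (HasTraceInequality.norm_sq_le hk0.le fun v hv => hK k hk Th hTh v hv) K.coe_nonneg
  have : FiniteDimensional ℂ (p1Space Ω Th) := finiteDimensional_p1Space hTh
  obtain ⟨hex, hle⟩ := schwarz_bound_of_coercive (v := ⟨v, hv⟩) hform
    (fun v => weightedNorm_eq (hΩ := hΩ.isOpen) (hbd := hΩ.isBounded) (hT := hTh) (h := hL) v)
    inner_energyMap (energyMap_injective hk0) hbdd hθ hA hc hcoer
    (schwarzSpace_le (Ωt := Ωt) hTh hTH hsub) (neighbours Ω Ωt) neighbours_symm hM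
    (fun i j hij u hu v hv => weightedInner_eq_zero_of_disjoint hTh hcov hij hu hv k)
  refine ⟨hex, le_of_mul_le_mul_left (hle.trans (le_of_eq ?_)) hc⟩
  simp only [c, A]
  field_simp

end AdditiveSchwarz

theorem theorem4p3 (d : ℕ) (hd : d = 2 ∨ d = 3)
    (Ω : Set (AdditiveSchwarz.Space d)) (hΩ : AdditiveSchwarz.IsLipschitzPolyhedron Ω)
    (Cε Cη k₀ : ℝ) (hk₀ : 0 < k₀) (M : ℕ) :
    ∃ C : ℝ, 0 < C ∧
      ∀ (k ε : ℝ) (η : ℂ), k₀ ≤ k → 0 < |ε| → |ε| ≤ Cε * k ^ 2 → ‖η‖ ≤ Cη * k →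
        0 ≤ (conj (AdditiveSchwarz.wavenumber k ε) * η).re →
      ∀ Th TH : Geometry.SimplicialComplex ℝ (AdditiveSchwarz.Space d),
        AdditiveSchwarz.IsMesh Ω Th → AdditiveSchwarz.IsMesh Ω TH →
        (∀ s ∈ AdditiveSchwarz.elements TH,
          AdditiveSchwarz.IsUnionOfElements Th
            (convexHull ℝ (s : Set (AdditiveSchwarz.Space d)))) →
      ∀ (N : ℕ) (Ωt : Fin N → Set (AdditiveSchwarz.Space d)),
        AdditiveSchwarz.IsSubdomainCover Ω Th Ωt →
        (∀ ℓ, (AdditiveSchwarz.neighbours Ω Ωt ℓ).ncard ≤ M) →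
      ∀ v ∈ AdditiveSchwarz.p1Space Ω Th,
        (∀ ℓ : Fin (N + 1), ∃! u, AdditiveSchwarz.IsProjection Ω k ε η
          (AdditiveSchwarz.schwarzSpace Ω Th TH Ωt ℓ) v u) ∧
        AdditiveSchwarz.weightedNorm Ω k
            (AdditiveSchwarz.schwarzOp Ω k ε η Th TH Ωt v) ≤
          C * (k ^ 2 / |ε|) * AdditiveSchwarz.weightedNorm Ω k v := by
  rcases hd with rfl | rfl
  · exact AdditiveSchwarz.schwarz_bound hΩ Cε Cη k₀ hk₀ M
  · exact AdditiveSchwarz.schwarz_bound hΩ Cε Cη k₀ hk₀ M
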